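/- \textbf{Theorem.} Let $G=(V,E)$ be a finite connected graph whose nodes are called goods, and let $u:V\to\mathbb{R}_{\ge 0}$ be a utility function, extended additively to sets of goods by $u(P)=\sum_{v\in P}u(v)$. A bundle is a set of goods that is empty or induces a connected subgraph of $G$. For $n\ge 1$, an $n$-split of $G$ is a sequence $P_1,\dots,P_n$ of pairwise disjoint (possibly empty) bundles with $P_1\cup\dots\cup P_n=V$. The maximin share is $$\mathrm{mms}^{(n)}(G,u)=\max\{q\ge 0 : \text{there is an } n\text{-split } P_1,\dots,P_n \text{ of } G \text{ with } u(P_i)\ge q \text{ for all } i\}.$$ Given utility functions $u_1,\dots,u_n$ of $n$ agents, an mms-allocation is an $n$-split $P_1,\dots,P_n$ of $G$ such that $u_i(P_i)\ge \mathrm{mms}^{(n)}(G,u_i)$ for every $i=1,\dots,n$. Consider the decision problem Mms-Alloc-G: given an (arbitrary) connected graph $G$ with $m\geq 1$ goods and $n\ge 1$ utility functions $u_1,\dots,u_n$ on $G$ with non-negative rational values, decide whether an mms-allocation for $G$ and $u_1,\dots,u_n$ exists. Here the graph is represented by its adjacency matrix, and the values of the utility functions are represented as fractions of integers written in binary. Then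 Mms-Alloc-G belongs to the class $\Delta_2^P=\mathrm{P}^{\mathrm{NP}}$: there are a language $A\in\mathrm{NP}$ and a deterministic Turing machine with oracle $A$ that decides Mms-Alloc-G in time polynomial in the length of the input, each oracle call being counted as one step. -/

import Mathlib

namespace FairDivision

/-! ### Maximin share allocations of goods on a graph -/

section Goods

variable {V : Type*} [Fintype V]

/-- The set `P` of goods is a `G`-bundle: it induces a connected subgraph of `G`.
The empty set is a bundle, hence `Preconnected` (Mathlib's `Connected` asks for a vertex). -/
def IsBundle (G : SimpleGraph V) (P : Finset V) : Prop :=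
  (G.induce (P : Set V)).Preconnected

/-- `P 0, …, P (n-1)` is a `(G,n)`-split: pairwise disjoint (possibly empty) bundles that
cover all goods.  It is also a `(G,n)`-allocation, agent `i` receiving `P i`. -/
structure IsSplit (G : SimpleGraph V) {n : ℕ} (P : Fin n → Finset V) : Prop where
  bundle : ∀ i, IsBundle G (P i)
  disjoint : ∀ i j, i ≠ j → Disjoint (P i) (P j)
  cover : ∀ v, ∃ i, v ∈ P i

/-- The additive value of a set of goods under the utility function `u`. -/
def value (u : V → ℝ) (P : Finset V) : ℝ := ∑ v ∈ P, u v

/-- A sequence of sets is `q`-strong under `u` if each of its members has value at least `q`. -/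
def IsStrong (u : V → ℝ) (q : ℝ) {n : ℕ} (P : Fin n → Finset V) : Prop :=
  ∀ i, q ≤ value u (P i)

/-- The nonnegative reals `q` for which there is a `q`-strong `n`-split of `G`. -/
def strongValues (G : SimpleGraph V) (u : V → ℝ) (n : ℕ) : Set ℝ :=
  {q | 0 ≤ q ∧ ∃ P : Fin n → Finset V, IsSplit G P ∧ IsStrong u q P}

/-- The maximin share `mms⁽ⁿ⁾(G,u)`, the largest `q` for which there is a `q`-strong `n`-split
of `G`.  By `mms_isGreatest` below, the supremum is a maximum. -/
noncomputable def mms (G : SimpleGraph V) (u : V → ℝ) (n : ℕ) : ℝ :=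
  sSup (strongValues G u n)

/-- `P` is an mms-allocation for the agents with utility functions `u 0, …, u (n-1)`. -/
def IsMmsAllocation (G : SimpleGraph V) {n : ℕ} (u : Fin n → V → ℝ) (P : Fin n → Finset V) :
    Prop :=
  IsSplit G P ∧ ∀ i, mms G (u i) n ≤ value (u i) (P i)

theorem mms_isGreatest (G : SimpleGraph V) (hG : G.Connected) (u : V → ℝ) (hu : ∀ v, 0 ≤ u v)
    (n : ℕ) (hn : 0 < n) : IsGreatest (strongValues G u n) (mms G u n) := by
  classical
  have hne : (strongValues G u n).Nonempty := by
    refine ⟨0, le_rfl, fun i => if i = ⟨0, hn⟩ then Finset.univ else ∅, ⟨?_, ?_, ?_⟩, ?_⟩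
    · intro i
      by_cases h : i = ⟨0, hn⟩
      · rintro ⟨v, hv⟩ ⟨w, hw⟩
        have key : ∀ a b : V, G.Reachable a b → ∀ ha hb,
            (G.induce ((if i = ⟨0, hn⟩ then Finset.univ else ∅ : Finset V) : Set V)).Reachable
              ⟨a, ha⟩ ⟨b, hb⟩ := by
          rintro a b ⟨p⟩
          induction p with
          | nil => intro _ _; exact SimpleGraph.Reachable.refl _
          | @cons a c b hac p ih =>
            intro ha hb
            have hc : c ∈ ((if i = ⟨0, hn⟩ then Finset.univ else ∅ : Finset V) : Set V) := by
              simp [h]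
            exact SimpleGraph.Reachable.trans
              (SimpleGraph.Adj.reachable (show (G.induce _).Adj ⟨a, ha⟩ ⟨c, hc⟩ from hac))
              (ih hc hb)
        exact key v w (hG.preconnected v w) hv hw
      · rintro ⟨v, hv⟩
        simp [h] at hv
    · intro i j hij
      by_cases h : i = ⟨0, hn⟩
      · have : j ≠ ⟨0, hn⟩ := fun h' => hij (h.trans h'.symm)
        simp [this]
      · simp [h]
    · intro v
      exact ⟨⟨0, hn⟩, by simp⟩
    · intro i
      exact Finset.sum_nonneg fun v _ => hu v
  have hfin : (Set.range fun P : Fin n → Finset V => value u (P ⟨0, hn⟩)).Finite :=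
    Set.finite_range _
  have hbdd : BddAbove (strongValues G u n) := by
    obtain ⟨B, hB⟩ := hfin.bddAbove
    exact ⟨B, fun q hq => by
      obtain ⟨-, P, -, hP⟩ := hq
      exact (hP _).trans (hB ⟨P, rfl⟩)⟩
  have hclosed : IsClosed (strongValues G u n) := by
    have : strongValues G u n = Set.Ici 0 ∩ ⋃ P ∈ {P : Fin n → Finset V | IsSplit G P},
        ⋂ i, Set.Iic (value u (P i)) := by
      ext q
      simp [strongValues, IsStrong]
    rw [this]
    exact isClosed_Ici.inter ((Set.toFinite _).isClosed_biUnion fun P _ =>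
      isClosed_iInter fun i => isClosed_Iic)
  exact ⟨hclosed.csSup_mem hne hbdd, fun q hq => le_csSup hbdd hq⟩

end Goods

/-! ### Instances of the problem and their binary representation -/

/-- An instance: a connected graph of goods on `m` nodes and `n` utility functions with
nonnegative rational values, that of agent `i` for good `v` being given as the (not necessarily
reduced) fraction `num i v / den i v`. -/
structure Instance where
  /-- the number of goods -/
  m : ℕ
  /-- the number of agents -/
  n : ℕ
  /-- the graph of goods -/
  G : SimpleGraph (Fin m)
  num : Fin n → Fin m → ℕ
  den : Fin n → Fin m → ℕ
  n_pos : 0 < n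
  connected : G.Connected
  den_pos : ∀ i v, 0 < den i v

namespace Instance

/-- The utility functions of the instance. -/
noncomputable def utility (I : Instance) (i : Fin I.n) (v : Fin I.m) : ℝ :=
  (I.num i v : ℝ) / (I.den i v : ℝ)

/-- The instance is a YES instance. -/
def HasMmsAllocation (I : Instance) : Prop :=
  ∃ P : Fin I.n → Finset (Fin I.m), IsMmsAllocation I.G I.utility P

end Instance

/-- `k` ones and a zero. -/
def encodeUnary (k : ℕ) : List Bool := List.replicate k true ++ [false]

/-- Self-delimiting encoding of a bit string: a one before each bit, and a zero at the end. -/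
def delimit (x : List Bool) : List Bool := x.flatMap (fun b => [true, b]) ++ [false]

/-- Self-delimiting encoding of the binary representation of a natural number. -/
def encodeNat (k : ℕ) : List Bool := delimit k.bits

open Classical in
/-- The representation of an instance as a bit string: `m`, `n`, the adjacency matrix of the
graph (row by row), and the numerators and denominators of the utilities (agent by agent), the
latter in binary. -/
noncomputable def Instance.encode (I : Instance) : List Bool :=
  encodeUnary I.m ++ (encodeUnary I.n ++
    (((List.finRange I.m).flatMap fun v =>
        (List.finRange I.m).flatMap fun w => [decide (I.G.Adj v w)]) ++
      ((List.finRange I.n).flatMap fun i =>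
        (List.finRange I.m).flatMap fun v => encodeNat (I.num i v) ++ encodeNat (I.den i v))))

section Injectivity

/-- A code that can be read off from the beginning of a string. -/
def PrefixFree {α : Type*} (c : α → List Bool) : Prop :=
  ∀ a b s t, c a ++ s = c b ++ t → a = b ∧ s = t

theorem prefixFree_unary : PrefixFree encodeUnary := by
  intro a
  induction a with
  | zero => intro b s t h; cases b <;> simp_all [encodeUnary, List.replicate_succ]
  | succ a ih =>
    intro b s t h
    cases b with
    | zero => simp [encodeUnary, List.replicate_succ] at h
    | succ b =>
      have := ih b s t (by simpa [encodeUnary, List.replicate_succ] using h)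
      exact ⟨by rw [this.1], this.2⟩

theorem prefixFree_delimit : PrefixFree delimit := by
  intro a
  induction a with
  | nil => intro b s t h; cases b <;> simp_all [delimit]
  | cons x a ih =>
    intro b s t h
    cases b with
    | nil => simp [delimit] at h
    | cons y b =>
      simp only [delimit, List.flatMap_cons, List.append_assoc, List.cons_append,
        List.nil_append, List.cons.injEq, true_and] at h
      have := ih b s t (by simpa [delimit] using h.2)
      exact ⟨by rw [this.1, h.1], this.2⟩

theorem prefixFree_nat : PrefixFree encodeNat := by
  intro a b s t h
  obtain ⟨h1, h2⟩ := prefixFree_delimit _ _ _ _ h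
  refine ⟨?_, h2⟩
  have key : ∀ k : ℕ, Nat.ofDigits 2 (k.bits.map fun b => cond b 1 0) = k := fun k => by
    rw [← Nat.digits_two_eq_bits, Nat.ofDigits_digits]
  rw [← key a, ← key b, h1]

theorem PrefixFree.pi {α β : Type*} {c : α → List Bool} (hc : PrefixFree c) (l : List β)
    (f g : β → α) (s t : List Bool)
    (h : l.flatMap (fun x => c (f x)) ++ s = l.flatMap (fun x => c (g x)) ++ t) :
    (∀ x ∈ l, f x = g x) ∧ s = t := by
  induction l with
  | nil => simpa using h
  | cons x l ih =>
    simp only [List.flatMap_cons, List.append_assoc] at h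
    obtain ⟨h1, h2⟩ := hc _ _ _ _ h
    obtain ⟨h3, h4⟩ := ih h2
    exact ⟨by simpa [h1] using h3, h4⟩

theorem PrefixFree.fin {α : Type*} {c : α → List Bool} (hc : PrefixFree c) (k : ℕ) :
    PrefixFree fun f : Fin k → α => (List.finRange k).flatMap fun x => c (f x) := by
  intro f g s t h
  obtain ⟨h1, h2⟩ := hc.pi _ _ _ _ _ h
  exact ⟨funext fun x => h1 x (List.mem_finRange x), h2⟩

/-- Different instances have different representations. -/
theorem Instance.encode_injective : Function.Injective Instance.encode := by
  classical
  rintro ⟨m, n, G, num, den, h1, h2, h3⟩ ⟨m', n', G', num', den', h1', h2', h3'⟩ h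
  simp only [Instance.encode] at h
  obtain ⟨rfl, h⟩ := prefixFree_unary _ _ _ _ h
  obtain ⟨rfl, h⟩ := prefixFree_unary _ _ _ _ h
  have hb : PrefixFree fun b : Bool => [b] := by
    intro a b s t h
    simpa using h
  have hp : PrefixFree fun p : ℕ × ℕ => encodeNat p.1 ++ encodeNat p.2 := by
    rintro ⟨a, b⟩ ⟨a', b'⟩ s t h
    simp only [List.append_assoc] at h
    obtain ⟨e, h⟩ := prefixFree_nat _ _ _ _ h
    obtain ⟨e', h⟩ := prefixFree_nat _ _ _ _ h
    exact ⟨Prod.ext e e', h⟩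
  obtain ⟨hG, h⟩ := (hb.fin m).fin m (fun v w => decide (G.Adj v w))
    (fun v w => decide (G'.Adj v w)) _ _ h
  obtain ⟨hu, -⟩ := (hp.fin m).fin n (fun i v => (num i v, den i v))
    (fun i v => (num' i v, den' i v)) [] [] (by simpa using h)
  have e1 : G = G' := by
    ext v w
    simpa using congrFun (congrFun hG v) w
  have e2 : num = num' := by
    funext i v
    exact congrArg Prod.fst (congrFun (congrFun hu i) v)
  have e3 : den = den' := by
    funext i v
    exact congrArg Prod.snd (congrFun (congrFun hu i) v)
  subst e1 e2 e3
  rfl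

end Injectivity

/-- The decision problem: the representations of the instances with an mms-allocation. -/
def MmsAllocG : Language Bool :=
  {x | ∃ I : Instance, I.encode = x ∧ I.HasMmsAllocation}

end FairDivision

/-! ### Oracle machines and the classes P, NP and Δ₂ᵖ -/

namespace Complexity

/-- A deterministic Turing machine with an oracle: one of Mathlib's (finite, multi-stack) Turing
machines, with a designated query stack and three special labels `ask`, `yes`, `no`.
Input, output and query stacks hold bits. -/
structure OracleTM extends Turing.FinTM2 where
  alphabetFinite : ∀ k, Finite (Γ k)
  /-- the query stack -/
  kq : K
  inputAlphabet : Γ k₀ ≃ Bool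
  outputAlphabet : Γ k₁ ≃ Bool
  queryAlphabet : Γ kq ≃ Bool
  /-- at this label the oracle is called -/
  ask : Λ
  /-- the label entered after a positive answer -/
  yes : Λ
  /-- the label entered after a negative answer -/
  no : Λ

namespace OracleTM

variable (M : OracleTM)

open Classical in
/-- One step with the oracle `A`.  At the label `ask` the machine moves to `yes` or `no`,
according to whether the content of the query stack (read from the top) is in `A`, and changes
nothing else; at any other label it makes an ordinary step. -/
noncomputable def stepWith (A : Language Bool) (c : M.Cfg) : Option M.Cfg :=
  if c.l = some M.ask then
    some ⟨some (if (c.stk M.kq).map M.queryAlphabet ∈ A then M.yes else M.no), c.var, c.stk⟩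
  else M.toFinTM2.step c

/-- The initial configuration on the input `x` (on the input stack, first bit on top). -/
def start (x : List Bool) : M.Cfg :=
  Turing.initList M.toFinTM2 (x.map M.inputAlphabet.symm)

/-- With the oracle `A`, the machine halts on each input `x` within `t |x|` steps, an oracle call
being one step, with a `1` on top of the output stack exactly if `x` is in `L`. -/
def DecidesInTime (A L : Language Bool) (t : ℕ → ℕ) : Prop :=
  ∀ x : List Bool, ∃ c : M.Cfg,
    Nonempty (StateTransition.EvalsToInTime (M.stepWith A) (M.start x) (some c) (t x.length)) ∧
    c.l = none ∧ (x ∈ L ↔ (c.stk M.k₁).head? = some (M.outputAlphabet.symm true))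

end OracleTM

/-- The class P with oracle `A`. -/
def PWith (A : Language Bool) : Set (Language Bool) :=
  {L | ∃ (M : OracleTM) (p : Polynomial ℕ), M.DecidesInTime A L fun k => p.eval k}

/-- The class P: deterministic polynomial time (with the useless oracle that always says no). -/
def P : Set (Language Bool) := PWith 0

/-- The pair of two bit strings, as a bit string. -/
def pair (x y : List Bool) : List Bool := FairDivision.delimit x ++ y

/-- The class NP: the languages with certificates of polynomial length that can be verified in
polynomial time. -/
def NP : Set (Language Bool) :=
  {L | ∃ R ∈ P, ∃ p : Polynomial ℕ, ∀ x : List Bool,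
    x ∈ L ↔ ∃ y : List Bool, y.length ≤ p.eval x.length ∧ pair x y ∈ R}

/-- The class `Δ₂ᵖ`: polynomial time with an oracle from NP. -/
def DeltaTwoP : Set (Language Bool) :=
  {L | ∃ A ∈ NP, L ∈ PWith A}

end Complexity

/-! Multiply the utilities of agent i by the product D_i of their denominators. Every set of goods
then has a natural number as its value, so D_i · mms_i is a natural number
(`scale_mul_mms_le_floor`), and for an input x it is less than 2^|x| (`floor_lt`). Whether some
split gives every part a scaled value of at least T for agent i is an NP question, answered
positively exactly for T ≤ D_i · mms_i (`exists_strong_iff`). Hence |x| oracle calls determine D_i ·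
mms_i digit by digit (`natOfBits_greedy`). When this is done for all agents, one more call asks for
a split whose i-th part reaches D_i · mms_i for agent i, for all i. Both questions have one form: a
list of pairs (agent, threshold), one for each part. So a single NP language serves as oracle.

A certificate contains, besides the split, the whole instance in explicit form; the verifier encodes
it again and compares the result with the input. By `Instance.encode_injective` it is the instance
in question, so the input need not be parsed, and an input that encodes no instance has no
certificate. Connectedness of a set is witnessed by an ordering in which each node but the last is
adjacent to a later one (`isBundle_nodes`, `exists_connB`). Certificates of polynomial size suffice
by `exists_small_cert`.

Running times are handled once and for all. Structured programs are compiled into oracle machines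
(`reach_of_exec`), and data are S-expressions, written on a stack in Polish notation. The functions
computable in polynomial time are closed under composition, pairing, case distinction, oracle calls,
and folds with polynomially bounded intermediate results (`foldl_of_bound`). The verifier and the
oracle algorithm are ordinary functions on lists and numbers, and they lie in this class by the way
they are built. -/

/-! ### Structured programs on five stacks of bits, and their oracle machines -/

namespace Complexity

/-- The stacks: a main stack, two buffers, a counter and the query stack. -/
inductive Stk | main | buf | aux | cnt | qry
  deriving DecidableEq

instance : Fintype Stk := ⟨{.main, .buf, .aux, .cnt, .qry}, by intro k; cases k <;> decide⟩

/-- Contents of the stacks. -/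
abbrev Store := Stk → List Bool

/-- The store with the given stack contents. -/
def store (m a b c q : List Bool) : Store
  | .main => m
  | .buf => a
  | .aux => b
  | .cnt => c
  | .qry => q

section
variable (m a b c q l : List Bool)

@[simp] theorem store_main : store m a b c q .main = m := rfl
@[simp] theorem store_buf : store m a b c q .buf = a := rfl
@[simp] theorem store_aux : store m a b c q .aux = b := rfl
@[simp] theorem store_cnt : store m a b c q .cnt = c := rfl
@[simp] theorem store_qry : store m a b c q .qry = q := rfl

@[simp] theorem update_store_main :
    Function.update (store m a b c q) .main l = store l a b c q := by
  funext k; cases k <;> rfl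
@[simp] theorem update_store_buf :
    Function.update (store m a b c q) .buf l = store m l b c q := by
  funext k; cases k <;> rfl
@[simp] theorem update_store_aux :
    Function.update (store m a b c q) .aux l = store m a l c q := by
  funext k; cases k <;> rfl
@[simp] theorem update_store_cnt :
    Function.update (store m a b c q) .cnt l = store m a b l q := by
  funext k; cases k <;> rfl
@[simp] theorem update_store_qry :
    Function.update (store m a b c q) .qry l = store m a b c l := by
  funext k; cases k <;> rfl
end

/-- Structured programs.  `pop k p r e` pops a bit `d` from the stack `k`, runs `p d`, and starts
again if `r d`; if the stack is empty it runs `e`.  `ask p` runs `p d`, where `d` is the answer of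
the oracle on the query stack. -/
inductive Prog
  | nop : Prog
  | push : Stk → Bool → Prog
  | seq : Prog → Prog → Prog
  | pop : Stk → (Bool → Prog) → (Bool → Bool) → Prog → Prog
  | ask : (Bool → Prog) → Prog

/-- `Exec A p s s' t`: with the oracle `A`, the program `p` leads from `s` to `s'` in `t` steps. -/
inductive Exec (A : Language Bool) : Prog → Store → Store → ℕ → Prop
  | nop (s) : Exec A .nop s s 1
  | push (k b s) : Exec A (.push k b) s (Function.update s k (b :: s k)) 1
  | seq {p q s s' s'' t t'} : Exec A p s s' t → Exec A q s' s'' t' →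
      Exec A (.seq p q) s s'' (t' + t)
  | leave {k p r e s s' t} (b l) : s k = b :: l → r b = false →
      Exec A (p b) (Function.update s k l) s' t → Exec A (.pop k p r e) s s' (t + 1)
  | again {k p r e s s' s'' t t'} (b l) : s k = b :: l → r b = true →
      Exec A (p b) (Function.update s k l) s' t → Exec A (.pop k p r e) s' s'' t' →
      Exec A (.pop k p r e) s s'' (t' + (t + 1))
  | empty {k p r e s s' t} : s k = [] → Exec A e s s' t → Exec A (.pop k p r e) s s' (t + 1)
  | ask {p s s' t} (b : Bool) : (s .qry ∈ A ↔ b = true) → Exec A (p b) s s' t →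
      Exec A (.ask p) s s' (t + 3)

/-! ### Compilation of programs into oracle machines -/

namespace Prog

/-- The labels of the machine of a program. -/
def Lab : Prog → Type
  | nop => Unit
  | push _ _ => Unit
  | seq p q => Lab p ⊕ Lab q
  | pop _ p _ e => Unit ⊕ ((Σ b : Bool, Lab (p b)) ⊕ Lab e)
  | ask p => Unit ⊕ (Σ b : Bool, Lab (p b))

/-- The label at which a program starts. -/
def entry : (p : Prog) → p.Lab
  | nop => ()
  | push _ _ => ()
  | seq p _ => .inl (entry p)
  | pop _ _ _ _ => .inl ()
  | ask _ => .inl ()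

theorem finite_lab : (p : Prog) → Finite p.Lab
  | nop => inferInstanceAs (Finite Unit)
  | push _ _ => inferInstanceAs (Finite Unit)
  | seq p q =>
    have := finite_lab p
    have := finite_lab q
    inferInstanceAs (Finite (Lab p ⊕ Lab q))
  | pop _ p _ e =>
    have := fun b => finite_lab (p b)
    have := finite_lab e
    inferInstanceAs (Finite (Unit ⊕ ((Σ b : Bool, Lab (p b)) ⊕ Lab e)))
  | ask p =>
    have := fun b => finite_lab (p b)
    inferInstanceAs (Finite (Unit ⊕ (Σ b : Bool, Lab (p b))))

/-- The internal states: the last bit popped, and the labels to go to after an oracle call. -/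
abbrev Reg (L : Type) := Option Bool × (Bool → L)

/-- Statements of the machine of a program, with the labels embedded in `L` by `f`, and exit
label `x`; the oracle is called at the label `o`. -/
def code {L : Type} (o : L) : (p : Prog) → (p.Lab → L) → L → p.Lab →
    Turing.TM2.Stmt (fun _ : Stk => Bool) L (Reg L)
  | nop, _, x, _ => .goto fun _ => x
  | push k b, _, x, _ => .push k (fun _ => b) (.goto fun _ => x)
  | seq p q, f, _, .inl l => code o p (fun l => f (.inl l)) (f (.inr q.entry)) l
  | seq _ q, f, x, .inr l => code o q (fun l => f (.inr l)) x l
  | pop k p _ e, f, _, .inl _ => .pop k (fun v d => (d, v.2)) (.goto fun v =>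
      match v.1 with
      | some b => f (.inr (.inl ⟨b, (p b).entry⟩))
      | none => f (.inr (.inr e.entry)))
  | pop _ p r _, f, x, .inr (.inl ⟨b, l⟩) =>
      code o (p b) (fun l => f (.inr (.inl ⟨b, l⟩))) (if r b then f (.inl ()) else x) l
  | pop _ _ _ e, f, x, .inr (.inr l) => code o e (fun l => f (.inr (.inr l))) x l
  | ask p, f, _, .inl _ => .load (fun v => (v.1, fun b => f (.inr ⟨b, (p b).entry⟩)))
      (.goto fun _ => o)
  | ask p, f, x, .inr ⟨b, l⟩ => code o (p b) (fun l => f (.inr ⟨b, l⟩)) x l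

/-- Labels of the control part of a machine. -/
inductive Ctl | ask | yes | no | exit
  deriving DecidableEq

instance : Fintype Ctl := ⟨{.ask, .yes, .no, .exit}, by intro k; cases k <;> decide⟩

/-- The oracle machine of a program. -/
noncomputable def machine (p : Prog) : OracleTM :=
  have := p.finite_lab
  let L := p.Lab ⊕ Ctl
  { K := Stk
    k₀ := .main
    k₁ := .main
    Γ := fun _ => Bool
    Λ := L
    main := .inl p.entry
    ΛFin := Fintype.ofFinite L
    σ := Reg L
    initialState := (none, fun _ => .inr .exit)
    σFin := Fintype.ofFinite _
    Γk₀Fin := inferInstanceAs (Fintype Bool)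
    m := fun l => match l with
      | .inl l => p.code (.inr .ask) (fun l => Sum.inl l) (.inr .exit) l
      | .inr .yes => .goto fun v => v.2 true
      | .inr .no => .goto fun v => v.2 false
      | .inr _ => .halt
    alphabetFinite := fun _ => inferInstanceAs (Finite Bool)
    kq := .qry
    inputAlphabet := Equiv.refl Bool
    outputAlphabet := Equiv.refl Bool
    queryAlphabet := Equiv.refl Bool
    ask := .inr .ask
    yes := .inr .yes
    no := .inr .no }

/-- A configuration of the machine of `p`. -/
def cfg (p : Prog) (l : p.Lab ⊕ Ctl) (v : Reg (p.Lab ⊕ Ctl)) (s : Store) : p.machine.Cfg :=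
  ⟨some l, v, s⟩

theorem step_cfg (A : Language Bool) (P : Prog) (l : P.Lab ⊕ Ctl) (h : l ≠ .inr .ask)
    (v : Reg (P.Lab ⊕ Ctl)) (s : Store) :
    P.machine.stepWith A (P.cfg l v s) = some (Turing.TM2.stepAux (P.machine.m l) v s) := by
  have : (P.cfg l v s).l ≠ some P.machine.ask := fun e => h (Option.some.inj e)
  rw [OracleTM.stepWith, if_neg this]
  rfl

theorem step_ask (A : Language Bool) (P : Prog) (v : Reg (P.Lab ⊕ Ctl)) (s : Store) (b : Bool)
    (h : s .qry ∈ A ↔ b = true) :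
    P.machine.stepWith A (P.cfg (.inr .ask) v s) =
      some (P.cfg (.inr (if b then .yes else .no)) v s) := by
  have : (P.cfg (.inr .ask) v s).l = some P.machine.ask := rfl
  rw [OracleTM.stepWith, if_pos this]
  have e : ((P.cfg (.inr .ask) v s).stk P.machine.kq).map P.machine.queryAlphabet = s .qry :=
    List.map_id _
  rw [e]
  cases b
  · rw [if_neg (by simpa using h)]; rfl
  · rw [if_pos (by simpa using h)]; rfl

/-- `Reach A P c c' t`: the machine of `P` goes from `c` to `c'` in exactly `t` steps. -/
abbrev Reach (A : Language Bool) (P : Prog) (c c' : P.machine.Cfg) (t : ℕ) : Prop :=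
  (flip bind (P.machine.stepWith A))^[t] (some c) = some c'

theorem Reach.trans {A : Language Bool} {P : Prog} {c c' c'' : P.machine.Cfg} {t t' : ℕ}
    (h : Reach A P c c' t) (h' : Reach A P c' c'' t') : Reach A P c c'' (t' + t) := by
  rw [Reach, Function.iterate_add_apply, h, h']

theorem Reach.single {A : Language Bool} {P : Prog} {c c' : P.machine.Cfg}
    (h : P.machine.stepWith A c = some c') : Reach A P c c' 1 := h

/-- Induction on the execution. The embedding `f` and the exit label `x` must be arbitrary, because
a subprogram sits inside a larger machine and continues wherever its context says. The initial
register `v` is arbitrary too: each construct sets the part of the register that it reads. -/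
theorem reach_of_exec {A : Language Bool} {P p : Prog} {s s' : Store} {t : ℕ}
    (h : Exec A p s s' t) : ∀ (f : p.Lab → P.Lab ⊕ Ctl) (x : P.Lab ⊕ Ctl)
    (_ : ∀ l, P.machine.m (f l) = p.code (.inr .ask) f x l) (_ : ∀ l, f l ≠ .inr .ask)
    (v : Reg (P.Lab ⊕ Ctl)),
    ∃ v', Reach A P (P.cfg (f p.entry) v s) (P.cfg x v' s') t := by
  induction h with
  | nop s =>
    intro f x hm ho v
    exact ⟨v, .single (by rw [step_cfg _ _ _ (ho _), hm]; rfl)⟩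
  | push k b s =>
    intro f x hm ho v
    refine ⟨v, .single ?_⟩
    rw [step_cfg _ _ _ (ho _), hm]; rfl
  | @seq p q s s' s'' t t' h h' ih ih' =>
    intro f x hm ho v
    obtain ⟨v1, h1⟩ := ih (fun l => f (.inl l)) (f (.inr q.entry)) (fun l => hm (.inl l))
      (fun l => ho (.inl l)) v
    obtain ⟨v2, h2⟩ := ih' (fun l => f (.inr l)) x (fun l => hm (.inr l)) (fun l => ho (.inr l)) v1
    exact ⟨v2, h1.trans h2⟩
  | @leave k p r e s s' t b l hk hr h ih =>
    intro f x hm ho v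
    obtain ⟨v1, h1⟩ := ih (fun l => f (.inr (.inl ⟨b, l⟩))) x
      (fun l => (hm _).trans (by simp [code, hr]; rfl)) (fun l => ho _) (some b, v.2)
    refine ⟨v1, Reach.trans (.single ?_) h1⟩
    rw [step_cfg _ _ _ (ho _), hm]
    simp only [entry, code, Turing.TM2.stepAux, hk]
    rfl
  | @again k p r e s s' s'' t t' b l hk hr h h' ih ih' =>
    intro f x hm ho v
    -- Since `r b` holds, the exit label of the body is the label of the loop itself.
    obtain ⟨v1, h1⟩ := ih (fun l => f (.inr (.inl ⟨b, l⟩))) (f (.inl ()))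
      (fun l => (hm _).trans (by simp [code, hr]; rfl)) (fun l => ho _) (some b, v.2)
    obtain ⟨v2, h2⟩ := ih' f x hm ho v1
    refine ⟨v2, Reach.trans (Reach.trans (.single ?_) h1) h2⟩
    rw [step_cfg _ _ _ (ho _), hm]
    simp only [entry, code, Turing.TM2.stepAux, hk]
    rfl
  | @empty k p r e s s' t hk h ih =>
    intro f x hm ho v
    obtain ⟨v1, h1⟩ := ih (fun l => f (.inr (.inr l))) x
      (fun l => hm _) (fun l => ho _) (none, v.2)
    refine ⟨v1, Reach.trans (.single ?_) h1⟩
    have : Function.update s k [] = s := by rw [← hk]; simp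
    rw [step_cfg _ _ _ (ho _), hm]
    simp only [entry, code, Turing.TM2.stepAux, hk]
    exact congrArg (fun s => some (P.cfg (f (.inr (.inr e.entry))) (none, v.2) s)) this
  | @ask p s s' t b hb h ih =>
    intro f x hm ho v
    -- The three steps of a call: the return labels are stored in the register, the oracle answers,
    -- and the label `yes` or `no` jumps to the stored return label.
    let w : Reg (P.Lab ⊕ Ctl) := (v.1, fun b => f (.inr ⟨b, (p b).entry⟩))
    obtain ⟨v1, h1⟩ := ih (fun l => f (.inr ⟨b, l⟩)) x (fun l => hm _) (fun l => ho _) w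
    have e1 : Reach A P (P.cfg (f (ask p).entry) v s) (P.cfg (.inr .ask) w s) 1 :=
      .single (by rw [step_cfg _ _ _ (ho _), hm]; rfl)
    have e2 := Reach.single (step_ask A P w s b hb)
    refine ⟨v1, Reach.trans (t' := t) (Reach.trans (t' := 1) (Reach.trans e1 e2) (.single ?_)) h1⟩
    cases b
    · rw [step_cfg _ _ _ (by simp)]; rfl
    · rw [step_cfg _ _ _ (by simp)]; rfl

/-- A language is in `P` with oracle `A` if some program decides it in polynomial time. -/
theorem mem_PWith {A L : Language Bool} (p : Prog) (T : Polynomial ℕ)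
    (h : ∀ x, ∃ s t, t ≤ T.eval x.length ∧ Exec A p (store x [] [] [] []) s t ∧
      (x ∈ L ↔ (s .main).head? = some true)) : L ∈ PWith A := by
  -- The additional step executes the halt statement at the exit label.
  refine ⟨p.machine, T + 1, fun x => ?_⟩
  obtain ⟨s, t, ht, he, hx⟩ := h x
  obtain ⟨v, hv⟩ := reach_of_exec (P := p) he (fun l => .inl l) (.inr .exit) (fun l => rfl)
    (fun l => by simp) p.machine.initialState
  refine ⟨⟨none, v, s⟩, ⟨⟨⟨1 + t, ?_⟩,
    by simp only [Polynomial.eval_add, Polynomial.eval_one]; omega⟩⟩, rfl, hx⟩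
  have hs : p.machine.start x = p.cfg (.inl p.entry) p.machine.initialState
      (store x [] [] [] []) := by
    have : (p.machine.start x).stk = store x [] [] [] [] := by
      funext k
      cases k
      · exact List.map_id x
      all_goals rfl
    exact congrArg (fun s => p.cfg (.inl p.entry) p.machine.initialState s) this
  rw [hs]
  refine Reach.trans hv (.single ?_)
  rw [step_cfg _ _ _ (by simp)]
  rfl

end Prog

end Complexity

/-! ### Polynomial-time functions on S-expressions -/

namespace Complexity

/-- S-expressions. -/
inductive Sexp | nil | cons (a b : Sexp)

namespace Sexp

/-- The code of an S-expression in Polish notation. -/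
def enc : Sexp → List Bool
  | nil => [false]
  | cons a b => true :: (a.enc ++ b.enc)

def size : Sexp → ℕ
  | nil => 1
  | cons a b => a.size + b.size + 1

def len : Sexp → ℕ
  | nil => 0
  | cons _ b => b.len + 1

def hd : Sexp → Sexp
  | nil => nil
  | cons a _ => a

def tl : Sexp → Sexp
  | nil => nil
  | cons _ b => b

/-- Truth values. -/
def ofBool (b : Bool) : Sexp := if b then cons nil nil else nil

@[simp] theorem length_enc (t : Sexp) : t.enc.length = t.size := by
  induction t with
  | nil => rfl
  | cons a b iha ihb => simp [enc, size, iha, ihb]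

theorem len_le_size (t : Sexp) : t.len ≤ t.size := by
  induction t with
  | nil => simp [len]
  | cons a b iha ihb => simp only [len, size]; omega

theorem one_le_size (t : Sexp) : 1 ≤ t.size := by
  cases t <;> simp [size]

theorem size_hd (t : Sexp) : t.hd.size ≤ t.size := by
  cases t <;> simp only [hd, size] <;> omega

theorem size_tl (t : Sexp) : t.tl.size ≤ t.size := by
  cases t <;> simp only [tl, size] <;> omega

end Sexp

open Sexp

theorem eval_mono (p : Polynomial ℕ) {a b : ℕ} (h : a ≤ b) : p.eval a ≤ p.eval b := by
  rw [Polynomial.eval_eq_sum, Polynomial.eval_eq_sum]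
  exact Finset.sum_le_sum fun i _ => Nat.mul_le_mul_left _ (Nat.pow_le_pow_left h i)

/-! ### Runs with a time bound -/

/-- `Runs A p s s' T`: the program `p` leads from `s` to `s'` in at most `T` steps. -/
def Runs (A : Language Bool) (p : Prog) (s s' : Store) (T : ℕ) : Prop :=
  ∃ t ≤ T, Exec A p s s' t

section Runs
variable {A : Language Bool} {p q : Prog} {s s' s'' : Store} {T T' : ℕ}

theorem Runs.mono (h : Runs A p s s' T) (hT : T ≤ T') : Runs A p s s' T' :=
  let ⟨t, ht, e⟩ := h
  ⟨t, ht.trans hT, e⟩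

theorem Runs.seq (h : Runs A p s s' T) (h' : Runs A q s' s'' T') :
    Runs A (.seq p q) s s'' (T + T') := by
  obtain ⟨t, ht, e⟩ := h
  obtain ⟨t', ht', e'⟩ := h'
  exact ⟨_, by omega, .seq e e'⟩

theorem Runs.nop : Runs A .nop s s 1 := ⟨1, le_rfl, .nop s⟩

theorem Runs.push (k b) : Runs A (.push k b) s (Function.update s k (b :: s k)) 1 :=
  ⟨1, le_rfl, .push k b s⟩

variable {k : Stk} {d : Bool → Prog} {r : Bool → Bool} {e : Prog}

theorem Runs.leave (b l) (hk : s k = b :: l) (hr : r b = false)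
    (h : Runs A (d b) (Function.update s k l) s' T) : Runs A (.pop k d r e) s s' (T + 1) := by
  obtain ⟨t, ht, h⟩ := h
  exact ⟨_, by omega, .leave b l hk hr h⟩

theorem Runs.again (b l) (hk : s k = b :: l) (hr : r b = true)
    (h : Runs A (d b) (Function.update s k l) s' T) (h' : Runs A (.pop k d r e) s' s'' T') :
    Runs A (.pop k d r e) s s'' (T + 1 + T') := by
  obtain ⟨t, ht, h⟩ := h
  obtain ⟨t', ht', h'⟩ := h'
  exact ⟨_, by omega, .again b l hk hr h h'⟩

theorem Runs.empty (hk : s k = []) (h : Runs A e s s' T) :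
    Runs A (.pop k d r e) s s' (T + 1) := by
  obtain ⟨t, ht, h⟩ := h
  exact ⟨_, by omega, .empty hk h⟩

theorem Runs.ask (b : Bool) (hb : s .qry ∈ A ↔ b = true) (h : Runs A (d b) s s' T) :
    Runs A (.ask d) s s' (T + 3) := by
  obtain ⟨t, ht, h⟩ := h
  exact ⟨_, by omega, .ask b hb h⟩

end Runs

/-! ### Programs that move, drop, copy and exchange S-expressions -/

/-- Empty the stack `k`, running `d` on its bits. -/
def drain (k : Stk) (d : Bool → Prog) : Prog := .pop k d (fun _ => true) .nop

/-- Everything outside the stack `k` is summarised by a state in `α`, on which one round acts as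
`g`; the loop is then a left fold. A round costs the body and one pop, and noticing the empty stack
costs 2. -/
theorem runs_drain {A : Language Bool} {k : Stk} {d : Bool → Prog} {α : Type}
    (S : List Bool → α → Store) (g : α → Bool → α) (c : ℕ) (hk : ∀ l a, S l a k = l)
    (hu : ∀ l l' a, Function.update (S l a) k l' = S l' a)
    (hd : ∀ l a b, Runs A (d b) (S l a) (S l (g a b)) c) (l : List Bool) (a : α) :
    Runs A (drain k d) (S l a) (S [] (l.foldl g a)) ((c + 1) * l.length + 2) := by
  induction l generalizing a with
  | nil => exact (Runs.empty (hk _ _) Runs.nop).mono (by simp)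
  | cons b l ih =>
    refine (Runs.again (T := c) b l (hk _ _) rfl ?_ (ih (g a b))).mono ?_
    · rw [hu]; exact hd l a b
    · simp only [List.length_cons]
      ring_nf
      omega

theorem foldl_flip_cons (l r : List Bool) : l.foldl (fun a b => b :: a) r = l.reverse ++ r := by
  induction l generalizing r with
  | nil => rfl
  | cons b l ih => simp [ih]

/-- Move the S-expression on the main stack to the stack `d`. -/
def moveTo (d : Stk) : Prog :=
  .seq (.push .cnt true) (drain .cnt fun _ => .pop .main (fun b => .seq (.push d b)
    (bif b then .seq (.push .cnt true) (.push .cnt true) else .nop)) (fun _ => false) .nop)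

/-- The counter stack holds, in unary, the number of S-expressions still to be read: in Polish
notation the bit `true` replaces one pending expression by two, and `false` completes one. The loop
thus stops at the end of the code without looking at what lies below. -/
theorem runs_moveTo {A : Language Bool} (d : Stk) (S : List Bool → List Bool → List Bool → Store)
    (hm : ∀ m a c, S m a c .main = m) (hd : ∀ m a c, S m a c d = a)
    (hc : ∀ m a c, S m a c .cnt = c)
    (hm' : ∀ m a c l, Function.update (S m a c) .main l = S l a c)
    (hd' : ∀ m a c l, Function.update (S m a c) d l = S m l c)
    (hc' : ∀ m a c l, Function.update (S m a c) .cnt l = S m a l) (t : Sexp) (r a : List Bool) :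
    Runs A (moveTo d) (S (t.enc ++ r) a []) (S r (t.enc.reverse ++ a) []) (5 * t.size + 3) := by
  -- The rest `c` of the counter and the run that follows are parameters, so that the two halves of
  -- a `cons` can be chained.
  have key : ∀ (t : Sexp) (r a c : List Bool) (s' : Store) (T : ℕ),
      Runs A (drain .cnt fun _ => .pop .main (fun b => .seq (.push d b)
        (bif b then .seq (.push .cnt true) (.push .cnt true) else .nop)) (fun _ => false) .nop)
        (S r (t.enc.reverse ++ a) c) s' T →
      Runs A (drain .cnt fun _ => .pop .main (fun b => .seq (.push d b)
        (bif b then .seq (.push .cnt true) (.push .cnt true) else .nop)) (fun _ => false) .nop)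
        (S (t.enc ++ r) a (true :: c)) s' (5 * t.size + T) := by
    intro t
    induction t with
    | nil =>
      intro r a c s' T h
      refine (Runs.again (T := 3) true c (hc _ _ _) rfl ?_ h).mono (by simp [size])
      rw [hc']
      refine (Runs.leave (T := 2) false r (by rw [hm]; rfl) rfl ?_)
      rw [hm']
      refine Runs.seq (T := 1) (T' := 1) (Runs.push _ _) ?_
      rw [hd, hd']
      exact Runs.nop
    | cons x y ihx ihy =>
      intro r a c s' T h
      have h1 := ihy r (x.enc.reverse ++ true :: a) c s' T (by simpa [enc] using h)
      have h2 := ihx (y.enc ++ r) (true :: a) (true :: c) s' _ h1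
      refine (Runs.again (T := 4) true c (hc _ _ _) rfl ?_ h2).mono (by simp [size]; omega)
      rw [hc']
      refine (Runs.leave (T := 3) true (x.enc ++ (y.enc ++ r)) (by rw [hm]; simp [enc]) rfl ?_)
      rw [hm']
      refine Runs.seq (T := 1) (T' := 2) (Runs.push _ _) ?_
      rw [hd, hd']
      have := Runs.seq (Runs.push (A := A) (s := S (x.enc ++ (y.enc ++ r)) (true :: a) c) .cnt true)
        (Runs.push .cnt true)
      rw [hc, hc', hc, hc'] at this
      exact this
  have h0 : Runs A (.push .cnt true) (S (t.enc ++ r) a []) (S (t.enc ++ r) a [true]) 1 := by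
    have := Runs.push (A := A) (s := S (t.enc ++ r) a []) .cnt true
    rwa [hc, hc'] at this
  refine (Runs.seq h0 (key t r a [] _ 2 ?_)).mono (by omega)
  exact Runs.empty (hc _ _ _) Runs.nop

/-- The store with only the main stack in use. -/
def mainStore (l : List Bool) : Store := store l [] [] [] []

section Primitives
variable {A : Language Bool}

/-- Remove the S-expression on the main stack. -/
def dropProg : Prog := .seq (moveTo .buf) (drain .buf fun _ => .nop)

theorem runs_moveTo_buf (t : Sexp) (m a b : List Bool) :
    Runs A (moveTo .buf) (store (t.enc ++ m) a b [] []) (store m (t.enc.reverse ++ a) b [] [])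
      (5 * t.size + 3) :=
  runs_moveTo .buf (fun m a c => store m a b c []) (by simp) (by simp) (by simp) (by simp)
    (by simp) (by simp) t m a

theorem runs_moveTo_aux (t : Sexp) (m a b : List Bool) :
    Runs A (moveTo .aux) (store (t.enc ++ m) a b [] []) (store m a (t.enc.reverse ++ b) [] [])
      (5 * t.size + 3) :=
  runs_moveTo .aux (fun m b c => store m a b c []) (by simp) (by simp) (by simp) (by simp)
    (by simp) (by simp) t m b

theorem runs_drop (t : Sexp) (r : List Bool) :
    Runs A dropProg (mainStore (t.enc ++ r)) (mainStore r) (10 * t.size + 10) := by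
  refine (Runs.seq (runs_moveTo_buf t r [] []) (runs_drain (fun l (_ : Unit) => store r l [] [] [])
    (fun _ _ => ()) 1 (by simp) (by simp) (fun _ _ _ => Runs.nop) _ ())).mono ?_
  simp
  omega

/-- Duplicate the S-expression on the main stack. -/
def dupProg : Prog :=
  .seq (moveTo .buf) (.seq (drain .buf fun b => .seq (.push .main b) (.push .aux b))
    (.seq (drain .aux fun b => .push .buf b) (drain .buf fun b => .push .main b)))

theorem runs_buf_main (l m b : List Bool) :
    Runs A (drain .buf fun b => .push .main b) (store m l b [] [])
      (store (l.reverse ++ m) [] b [] []) (2 * l.length + 2) := by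
  rw [← foldl_flip_cons]
  exact runs_drain (fun l m => store m l b [] []) (fun a b => b :: a) 1 (by simp) (by simp)
    (fun l m b => by simpa using Runs.push (A := A) (s := store m l _ [] []) .main b) l m

theorem runs_aux_main (l m a : List Bool) :
    Runs A (drain .aux fun b => .push .main b) (store m a l [] [])
      (store (l.reverse ++ m) a [] [] []) (2 * l.length + 2) := by
  rw [← foldl_flip_cons]
  exact runs_drain (fun l m => store m a l [] []) (fun a b => b :: a) 1 (by simp) (by simp)
    (fun l m b => by simpa using Runs.push (A := A) (s := store m _ l [] []) .main b) l m

theorem runs_dup (t : Sexp) (r : List Bool) :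
    Runs A dupProg (mainStore (t.enc ++ r)) (mainStore (t.enc ++ (t.enc ++ r)))
      (20 * t.size + 20) := by
  have h1 := runs_moveTo_buf (A := A) t r [] []
  have h2 := runs_drain (A := A) (k := .buf) (d := fun b => .seq (.push .main b) (.push .aux b))
    (fun l (x : List Bool × List Bool) => store x.1 l x.2 [] [])
    (fun x b => (b :: x.1, b :: x.2)) 2 (by simp) (by simp)
    (fun l x b => by
      have := Runs.seq (Runs.push (A := A) (s := store x.1 l x.2 [] []) .main b) (Runs.push .aux b)
      simpa using this) (t.enc.reverse ++ []) (r, [])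
  have e : ∀ (l x y : List Bool), l.foldl (fun x b => (b :: x.1, b :: x.2)) (x, y) =
      (l.reverse ++ x, l.reverse ++ y) := by
    intro l
    induction l with
    | nil => simp
    | cons b l ih => intro x y; simp [ih]
  have h3 := runs_drain (A := A) (k := .aux) (d := fun b => .push .buf b)
    (fun l x => store (t.enc ++ r) x l [] []) (fun x b => b :: x) 1 (by simp) (by simp)
    (fun l x b => by simpa using Runs.push (A := A) (s := store (t.enc ++ r) x l [] []) .buf b)
    t.enc []
  have h4 := runs_buf_main (A := A) (t.enc.reverse ++ []) (t.enc ++ r) []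
  rw [e] at h2
  rw [foldl_flip_cons] at h3
  simp only [List.append_nil, List.reverse_reverse, List.length_reverse, length_enc]
    at h1 h2 h3 h4
  exact (h1.seq (h2.seq (h3.seq h4))).mono (by omega)

/-- Exchange the two S-expressions on top of the main stack. -/
def swapProg : Prog :=
  .seq (moveTo .buf) (.seq (moveTo .aux) (.seq (drain .buf fun b => .push .main b)
    (drain .aux fun b => .push .main b)))

theorem runs_swap (t u : Sexp) (r : List Bool) :
    Runs A swapProg (mainStore (t.enc ++ (u.enc ++ r))) (mainStore (u.enc ++ (t.enc ++ r)))
      (10 * t.size + 10 * u.size + 20) := by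
  have h1 := runs_moveTo_buf (A := A) t (u.enc ++ r) [] []
  have h2 := runs_moveTo_aux (A := A) u r (t.enc.reverse ++ []) []
  have h3 := runs_buf_main (A := A) (t.enc.reverse ++ []) r (u.enc.reverse ++ [])
  have h4 := runs_aux_main (A := A) (u.enc.reverse ++ []) (t.enc ++ r) []
  simp only [List.append_nil, List.reverse_reverse, List.length_reverse, length_enc]
    at h1 h2 h3 h4
  exact (h1.seq (h2.seq (h3.seq h4))).mono (by omega)

theorem runs_push_main (b : Bool) (l : List Bool) :
    Runs A (.push .main b) (mainStore l) (mainStore (b :: l)) 1 := by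
  have := Runs.push (A := A) (s := mainStore l) .main b
  rwa [mainStore, update_store_main] at this

end Primitives

theorem enc_cons_append (a b : Sexp) (r : List Bool) :
    (Sexp.cons a b).enc ++ r = true :: (a.enc ++ (b.enc ++ r)) := by
  simp [enc]

theorem Runs.main_leave {A : Language Bool} {d : Bool → Prog} {q : Bool → Bool} {e : Prog}
    {s' : Store} {T : ℕ} (b : Bool) (l : List Bool) (hr : q b = false)
    (h : Runs A (d b) (mainStore l) s' T) :
    Runs A (.pop .main d q e) (mainStore (b :: l)) s' (T + 1) :=
  Runs.leave b l rfl hr (by rwa [mainStore, update_store_main])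

theorem Runs.main_again {A : Language Bool} {d : Bool → Prog} {q : Bool → Bool} {e : Prog}
    {s' s'' : Store} {T T' : ℕ} (b : Bool) (l : List Bool) (hr : q b = true)
    (h : Runs A (d b) (mainStore l) s' T) (h' : Runs A (.pop .main d q e) s' s'' T') :
    Runs A (.pop .main d q e) (mainStore (b :: l)) s'' (T + 1 + T') :=
  Runs.again b l rfl hr (by rwa [mainStore, update_store_main]) h'

/-- The S-expression of a list of bits. -/
def Sexp.ofBits (l : List Bool) : Sexp :=
  l.foldr (fun b t => Sexp.cons (ofBool b) t) Sexp.nil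

theorem Sexp.size_ofBits_le (l : List Bool) : (ofBits l).size ≤ 4 * l.length + 1 := by
  induction l with
  | nil => simp [ofBits, size]
  | cons b l ih =>
    have : (ofBool b).size ≤ 3 := by cases b <;> simp [ofBool, size]
    simp only [ofBits, List.foldr_cons, size, List.length_cons] at ih ⊢
    omega

/-! ### Functions computed by programs -/

/-- Some program computes `f a` from `e a` in polynomial time with the oracle `A`. -/
def FP (A : Language Bool) {α : Type} (e f : α → Sexp) : Prop :=
  ∃ (p : Prog) (P : Polynomial ℕ), ∀ a, (f a).size ≤ P.eval (e a).size ∧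
    ∀ r, Runs A p (mainStore ((e a).enc ++ r)) (mainStore ((f a).enc ++ r)) (P.eval (e a).size)

namespace FP
variable {A : Language Bool} {α β : Type} {e f g h : α → Sexp}

theorem reindex (hf : FP A e f) (u : β → α) : FP A (fun b => e (u b)) (fun b => f (u b)) := by
  obtain ⟨p, P, hp⟩ := hf
  exact ⟨p, P, fun b => hp (u b)⟩

theorem id : FP A e e :=
  ⟨.nop, Polynomial.X + 1, fun t => ⟨by simp, fun r => Runs.nop.mono (by simp)⟩⟩

theorem comp (hg : FP A f g) (hf : FP A e f) : FP A e g := by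
  obtain ⟨p, P, hp⟩ := hf
  obtain ⟨q, Q, hq⟩ := hg
  refine ⟨.seq p q, P + Q.comp P, fun t => ⟨?_, fun r => ?_⟩⟩
  · have := (hq t).1.trans (eval_mono Q (hp t).1)
    simp only [Polynomial.eval_add, Polynomial.eval_comp]
    omega
  · refine (Runs.seq ((hp t).2 r) ((hq t).2 r)).mono ?_
    have := eval_mono Q (hp t).1
    simp only [Polynomial.eval_add, Polynomial.eval_comp]
    omega

theorem nil : FP A e (fun _ => nil) :=
  ⟨.seq dropProg (.push .main false), 10 * Polynomial.X + 11, fun t => ⟨by simp [size], fun r =>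
    ((runs_drop (e t) r).seq (runs_push_main false r)).mono (by simp)⟩⟩

/-- The argument is copied, `f` is computed on the upper copy, the results are exchanged, `g` is
computed on the other copy, and after another exchange the tag of a pair is pushed. This works
because a program leaves what lies below its argument untouched. -/
theorem cons (hf : FP A e f) (hg : FP A e g) : FP A e (fun t => cons (f t) (g t)) := by
  obtain ⟨p, P, hp⟩ := hf
  obtain ⟨q, Q, hq⟩ := hg
  refine ⟨.seq dupProg (.seq p (.seq swapProg (.seq q (.seq swapProg (.push .main true))))),
    30 * Polynomial.X + 21 * P + 11 * Q + 100, fun t => ⟨?_, fun r => ?_⟩⟩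
  · have h1 := (hp t).1
    have h2 := (hq t).1
    simp [size]
    omega
  · have h1 := runs_dup (A := A) (e t) r
    have h2 := (hp t).2 ((e t).enc ++ r)
    have h3 := runs_swap (A := A) (f t) (e t) r
    have h4 := (hq t).2 ((f t).enc ++ r)
    have h5 := runs_swap (A := A) (g t) (f t) r
    have h6 := runs_push_main (A := A) true ((f t).enc ++ ((g t).enc ++ r))
    have b1 := (hp t).1
    have b2 := (hq t).1
    have := h1.seq (h2.seq (h3.seq (h4.seq (h5.seq h6))))
    simp only [enc, List.cons_append, List.append_assoc]
    refine this.mono ?_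
    simp
    omega

theorem const (c : Sexp) : FP A e (fun _ => c) := by
  induction c with
  | nil => exact nil
  | cons a b iha ihb => exact iha.cons ihb

theorem hd : FP A e (fun t => (e t).hd) := by
  refine ⟨.pop .main (fun b => bif b then .seq swapProg dropProg else .push .main false)
    (fun _ => false) .nop, 30 * Polynomial.X + 100, fun t => ⟨?_, fun r => ?_⟩⟩
  · have := (e t).size_hd
    simp
    omega
  · beta_reduce
    generalize e t = u
    cases u with
    | nil =>
      exact Runs.mono (T := 2) (Runs.main_leave (b := false) (l := r) (by rfl)
        (runs_push_main false r)) (by simp)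
    | cons a b =>
      rw [enc_cons_append]
      refine (Runs.main_leave true _ rfl
        ((runs_swap a b r).seq (runs_drop b (a.enc ++ r)))).mono ?_
      simp [size]
      omega

theorem tl : FP A e (fun t => (e t).tl) := by
  refine ⟨.pop .main (fun b => bif b then dropProg else .push .main false)
    (fun _ => false) .nop, 30 * Polynomial.X + 100, fun t => ⟨?_, fun r => ?_⟩⟩
  · have := (e t).size_tl
    simp
    omega
  · beta_reduce
    generalize e t = u
    cases u with
    | nil =>
      exact Runs.mono (T := 2) (Runs.main_leave (b := false) (l := r) (by rfl)
        (runs_push_main false r)) (by simp)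
    | cons a b =>
      rw [enc_cons_append]
      refine (Runs.main_leave true _ rfl (runs_drop a (b.enc ++ r))).mono ?_
      simp [size]
      omega

/-- The condition is computed on a copy of the argument. Its first bit decides; if it was `true`,
the two components of the condition still have to be removed before the argument is accessible. -/
theorem ite (hh : FP A e h) (hf : FP A e f) (hg : FP A e g) :
    FP A e (fun t => match h t with | .nil => g t | .cons _ _ => f t) := by
  obtain ⟨p, P, hp⟩ := hf
  obtain ⟨q, Q, hq⟩ := hg
  obtain ⟨o, O, ho⟩ := hh
  refine ⟨.seq dupProg (.seq o (.pop .main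
    (fun b => bif b then .seq dropProg (.seq dropProg p) else q) (fun _ => false) .nop)),
    20 * Polynomial.X + P + Q + 11 * O + 100, fun t => ⟨?_, fun r => ?_⟩⟩
  · have h1 := (hp t).1
    have h2 := (hq t).1
    simp
    split <;> omega
  · have h1 := runs_dup (A := A) (e t) r
    have h2 := (ho t).2 ((e t).enc ++ r)
    have b1 := (ho t).1
    refine ((h1.seq (h2.seq
      (T' := P.eval (e t).size + Q.eval (e t).size + 10 * O.eval (e t).size + 50) ?_))).mono ?_
    · cases hht : h t with
      | nil =>
        simp only [hht]
        refine (Runs.main_leave false ((e t).enc ++ r) rfl ((hq t).2 r)).mono ?_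
        omega
      | cons a b =>
        rw [hht] at b1
        simp only [hht]
        rw [enc_cons_append]
        refine (Runs.main_leave true _ rfl ((runs_drop _ _).seq ((runs_drop _ _).seq
            ((hp t).2 r)))).mono ?_
        simp only [size] at b1
        omega
    · simp
      omega

/-- Iteration, as long as the size of the iterates is bounded by a polynomial. -/
theorem iterate {e' : β → Sexp} {u : β → β} (hu : FP A e' (fun b => e' (u b)))
    {n : α → Sexp} (hn : FP A e n) {x : α → β} (hx : FP A e (fun a => e' (x a)))
    (Q : Polynomial ℕ) (hQ : ∀ a, ∀ k ≤ (n a).len, (e' (u^[k] (x a))).size ≤ Q.eval (e a).size) :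
    FP A e (fun a => e' (u^[(n a).len] (x a))) := by
  obtain ⟨p, P, hp⟩ := hu
  -- The list that counts the rounds lies on top of the argument. A round removes its first element,
  -- brings the argument to the top, applies `p`, and exchanges the two again.
  let body : Prog := .seq dropProg (.seq swapProg (.seq p swapProg))
  let loop : Prog := .pop .main (fun b => bif b then body else .nop) (fun b => b) .nop
  have key : ∀ (B : ℕ) (n : Sexp) (x : β) (r : List Bool), n.size ≤ B →
      (∀ k ≤ n.len, (e' (u^[k] x)).size ≤ B) →
      Runs A loop (mainStore (n.enc ++ ((e' x).enc ++ r)))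
        (mainStore ((e' (u^[n.len] x)).enc ++ r)) (n.len * (60 * B + P.eval B + 60) + 2) := by
    intro B n
    induction n with
    | nil =>
      intro x r _ _
      exact (Runs.main_leave false ((e' x).enc ++ r) rfl Runs.nop).mono (by simp [len])
    | cons a n _ ih =>
      intro x r hn hB
      have h0 := hB 0 (by simp)
      have h1 := hB 1 (by simp [len])
      simp only [size, Function.iterate_zero, id_eq, Function.iterate_one] at hn h0 h1
      have hi := ih (u x) r (by omega) (fun k hk => by
        have := hB (k + 1) (by simp only [len]; omega)
        rwa [Function.iterate_succ_apply] at this)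
      have hP := eval_mono P h0
      rw [enc_cons_append]
      refine (Runs.main_again true _ rfl
        (((runs_drop _ _).seq ((runs_swap _ _ _).seq (((hp x).2 _).seq (runs_swap _ _ _))))) hi
        ).mono ?_
      simp only [len, add_mul]
      omega
  obtain ⟨o, O, ho⟩ := hn.cons hx
  -- With B = O + Q bounding the counting list and all iterates, there are at most B rounds of cost
  -- at most 60 B + P(B) + 60. The outer `pop` removes the tag of the pair made of the list and the
  -- initial value.
  refine ⟨.seq o (.pop .main (fun b => bif b then loop else .nop) (fun _ => false) .nop),
    O + (O + Q) * (60 * (O + Q) + P.comp (O + Q) + 60) + Q + 10, fun a => ⟨?_, fun r => ?_⟩⟩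
  · have := hQ a _ le_rfl
    simp only [Polynomial.eval_add]
    omega
  · let B := O.eval (e a).size + Q.eval (e a).size
    have hs := (ho a).1
    simp only [size] at hs
    have hi := key B (n a) (x a) r (by simp only [B]; omega)
      (fun k hk => (hQ a k hk).trans (Nat.le_add_left _ _))
    have h1 := (ho a).2 r
    rw [enc_cons_append] at h1
    refine (h1.seq (Runs.main_leave true _ rfl hi)).mono ?_
    have hl : (n a).len ≤ B := by
      have := (n a).len_le_size
      simp only [B]; omega
    have := Nat.mul_le_mul_right (60 * B + P.eval B + 60) hl
    simp only [Polynomial.eval_add, Polynomial.eval_mul, Polynomial.eval_comp,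
      Polynomial.eval_ofNat]
    rw [show O.eval (e a).size + Q.eval (e a).size = B from rfl]
    omega

open Classical in
/-- A call of the oracle. -/
theorem oracle : FP A e (fun t => ofBool (decide ((e t).enc ∈ A))) := by
  -- The move to the buffer reverses the code and the move to the query stack restores it, so that
  -- the oracle reads it from the top. Afterwards the query stack is emptied, which makes further
  -- calls possible.
  refine ⟨.seq (moveTo .buf) (.seq (drain .buf fun b => .push .qry b)
    (.seq (.ask fun b => bif b then
      .seq (.push .main false) (.seq (.push .main false) (.push .main true)) else .push .main false)
      (drain .qry fun _ => .nop))), 20 * Polynomial.X + 40, fun a => ⟨?_, fun r => ?_⟩⟩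
  · by_cases h : (e a).enc ∈ A <;> simp [ofBool, size, h]
  · beta_reduce
    generalize e a = t
    have h1 := runs_moveTo_buf (A := A) t r [] []
    have h2 := runs_drain (A := A) (k := .buf) (d := fun b => .push .qry b)
      (fun l q => store r l [] [] q) (fun x b => b :: x) 1 (by simp) (by simp)
      (fun l x b => by simpa using Runs.push (A := A) (s := store r l [] [] x) .qry b)
      (t.enc.reverse ++ []) []
    have h4 := runs_drain (A := A) (k := .qry) (d := fun _ => .nop) (fun l (_ : Unit) =>
      store ((ofBool (decide (t.enc ∈ A))).enc ++ r) [] [] [] l) (fun _ _ => ()) 1 (by simp)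
      (by simp) (fun _ _ _ => Runs.nop) t.enc ()
    rw [foldl_flip_cons] at h2
    simp only [List.append_nil, List.reverse_reverse, List.length_reverse, length_enc] at h1 h2 h4
    refine (h1.seq (h2.seq (Runs.seq (T := 6) (Runs.ask (T := 3) (decide (t.enc ∈ A))
      (by simp) ?_) h4))).mono ?_
    rotate_left
    · simp
      omega
    by_cases h : t.enc ∈ A
    · have := (Runs.push (A := A) (s := store r [] [] [] t.enc) .main false).seq
        ((Runs.push .main false).seq (Runs.push .main true))
      simpa [h, ofBool, enc] using this
    · have := Runs.push (A := A) (s := store r [] [] [] t.enc) .main false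
      simpa [h, ofBool, enc] using this.mono (T' := 3) (by omega)

/-- Turn the bits on the main stack into an S-expression. -/
def readProg : Prog :=
  .seq (drain .main fun b => .push .buf b) (.seq (.push .main false) (drain .buf fun b =>
    .seq (.push .main false)
      (.seq (bif b then .seq (.push .main false) (.push .main true) else .nop)
      (.push .main true))))

theorem runs_readProg (l : List Bool) :
    Runs A readProg (mainStore l) (mainStore (ofBits l).enc) (20 * l.length + 20) := by
  have h1 := runs_drain (A := A) (k := .main) (d := fun b => .push .buf b)
    (fun l a => store l a [] [] []) (fun x b => b :: x) 1 (by simp) (by simp)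
    (fun l x b => by simpa using Runs.push (A := A) (s := store l x [] [] []) .buf b) l []
  rw [foldl_flip_cons, List.append_nil] at h1
  have h2 := Runs.push (A := A) (s := store [] l.reverse [] [] []) .main false
  have h3 := runs_drain (A := A) (k := .buf) (d := fun b => .seq (.push .main false)
      (.seq (bif b then .seq (.push .main false) (.push .main true) else .nop) (.push .main true)))
    (fun l (t : Sexp) => store t.enc l [] [] []) (fun t b => Sexp.cons (ofBool b) t) 4 (by simp)
    (by simp) (fun l t b => by
      cases b
      · have := (Runs.push (A := A) (s := store t.enc l [] [] []) .main false).seq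
          (Runs.nop.seq (Runs.push .main true))
        simpa [ofBool, enc] using this.mono (T' := 4) (by omega)
      · have := (Runs.push (A := A) (s := store t.enc l [] [] []) .main false).seq
          (((Runs.push .main false).seq (Runs.push .main true)).seq (Runs.push .main true))
        simpa [ofBool, enc] using this) l.reverse Sexp.nil
  rw [List.foldl_reverse] at h3
  simp only [update_store_main, List.length_reverse] at h2 h3
  exact (h1.seq (h2.seq h3)).mono (by omega)

/-- A language is in `P` with oracle `A` if a Boolean polynomial-time function decides it. -/
theorem mem_PWith {L : Language Bool} {f : List Bool → Bool}
    (hf : FP A ofBits (fun l => ofBool (f l))) (h : ∀ x, x ∈ L ↔ f x = true) : L ∈ PWith A := by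
  obtain ⟨p, P, hp⟩ := hf
  refine Prog.mem_PWith (.seq readProg p) (20 * Polynomial.X + 20 + P.comp (4 * Polynomial.X + 1))
    fun x => ?_
  have h1 := (hp x).2 []
  rw [List.append_nil, List.append_nil] at h1
  obtain ⟨t, ht, he⟩ := (runs_readProg x).seq h1
  refine ⟨_, t, ht.trans ?_, he, ?_⟩
  · have := eval_mono P (size_ofBits_le x)
    simp
    omega
  · rw [h]
    beta_reduce
    cases f x <;> simp [mainStore, ofBool, enc]

end FP

end Complexity

/-! ### Polynomial-time functions on represented types -/

namespace Complexity

open Sexp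

/-- Types whose elements are represented by S-expressions. -/
class HasRep (α : Type) where
  rep : α → Sexp

open HasRep

instance : HasRep Sexp := ⟨id⟩
instance : HasRep Bool := ⟨ofBool⟩
instance {α β : Type} [HasRep α] [HasRep β] : HasRep (α × β) := ⟨fun p => .cons (rep p.1) (rep p.2)⟩
instance {α : Type} [HasRep α] : HasRep (List α) :=
  ⟨fun l => l.foldr (fun a t => .cons (rep a) t) .nil⟩
/-- Natural numbers are represented in binary. -/
instance : HasRep ℕ := ⟨fun n => rep n.bits⟩

/-- The size of the representation. -/
def esize {α : Type} [HasRep α] (a : α) : ℕ := (rep a).size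

section Size
variable {α β : Type} [HasRep α] [HasRep β]

@[simp] theorem esize_pair (p : α × β) : esize p = esize p.1 + esize p.2 + 1 := rfl
@[simp] theorem esize_nil : esize ([] : List α) = 1 := rfl
@[simp] theorem esize_cons (a : α) (l : List α) : esize (a :: l) = esize a + esize l + 1 := rfl
theorem esize_bool (b : Bool) : esize b ≤ 3 := by cases b <;> simp [esize, rep, ofBool, size]
theorem one_le_esize (a : α) : 1 ≤ esize a := Sexp.one_le_size _

theorem len_rep (l : List α) : (rep l).len = l.length := by
  induction l with
  | nil => rfl
  | cons a l ih => simpa [rep, len] using ih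

theorem length_le_esize (l : List α) : l.length ≤ esize l :=
  len_rep l ▸ Sexp.len_le_size _

theorem esize_le_of_mem {a : α} {l : List α} (h : a ∈ l) : esize a ≤ esize l := by
  induction l with
  | nil => simp at h
  | cons b l ih =>
    rcases List.mem_cons.1 h with rfl | h
    · simp only [esize_cons]; omega
    · have := ih h
      simp only [esize_cons]; omega

theorem esize_append (l l' : List α) : esize (l ++ l') + 1 = esize l + esize l' := by
  induction l with
  | nil => simp; omega
  | cons a l ih => simp only [List.cons_append, esize_cons]; omega

theorem esize_reverse (l : List α) : esize l.reverse = esize l := by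
  induction l with
  | nil => rfl
  | cons a l ih =>
    have := esize_append l.reverse [a]
    simp only [List.reverse_cons, esize_cons, esize_nil] at this ⊢
    omega

theorem esize_drop_le (l : List α) (k : ℕ) : esize (l.drop k) ≤ esize l := by
  have := esize_append (l.take k) (l.drop k)
  have := one_le_esize (l.take k)
  rw [List.take_append_drop] at *
  omega

theorem esize_list_le (l : List α) (B : ℕ) (h : ∀ a ∈ l, esize a ≤ B) :
    esize l ≤ l.length * (B + 1) + 1 := by
  induction l with
  | nil => simp
  | cons a l ih =>
    have h1 := h a (by simp)
    have h2 := ih fun b hb => h b (by simp [hb])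
    simp only [esize_cons, List.length_cons, add_mul]
    omega

end Size

/-- `f` is computed in polynomial time with the oracle `A`. -/
def PolyTime (A : Language Bool) {α β : Type} [HasRep α] [HasRep β] (f : α → β) : Prop :=
  FP A (fun a => rep a) (fun a => rep (f a))

/-- `m` is bounded by a polynomial in the size of the argument. -/
def PolyBound {α : Type} [HasRep α] (m : α → ℕ) : Prop :=
  ∃ P : Polynomial ℕ, ∀ a, m a ≤ P.eval (esize a)

namespace PolyBound
variable {α : Type} [HasRep α] {m m' : α → ℕ}

theorem const (k : ℕ) : PolyBound fun _ : α => k := ⟨Polynomial.C k, fun a => by simp⟩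

theorem esize : PolyBound fun a : α => esize a := ⟨Polynomial.X, fun a => by simp⟩

theorem add (h : PolyBound m) (h' : PolyBound m') : PolyBound fun a => m a + m' a := by
  obtain ⟨P, hP⟩ := h
  obtain ⟨Q, hQ⟩ := h'
  exact ⟨P + Q, fun a => by simpa using add_le_add (hP a) (hQ a)⟩

theorem mul (h : PolyBound m) (h' : PolyBound m') : PolyBound fun a => m a * m' a := by
  obtain ⟨P, hP⟩ := h
  obtain ⟨Q, hQ⟩ := h'
  exact ⟨P * Q, fun a => by simpa using Nat.mul_le_mul (hP a) (hQ a)⟩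

theorem eval (h : PolyBound m) (Q : Polynomial ℕ) : PolyBound fun a => Q.eval (m a) := by
  obtain ⟨P, hP⟩ := h
  exact ⟨Q.comp P, fun a => by simpa using eval_mono Q (hP a)⟩

end PolyBound

/-- Case distinction on a list. -/
def listElim {β γ : Type} (l : List β) (x : γ) (f : β → List β → γ) : γ :=
  match l with
  | [] => x
  | b :: t => f b t

section
variable {β γ : Type} (x : γ) (f : β → List β → γ) (b : β) (t : List β)
@[simp] theorem listElim_nil : listElim [] x f = x := rfl
@[simp] theorem listElim_cons : listElim (b :: t) x f = f b t := rfl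
end

/-! ### Closure properties and list functions -/

namespace PolyTime
variable {A : Language Bool} {α β γ σ : Type} [HasRep α] [HasRep β] [HasRep γ] [HasRep σ]

theorem bound {f : α → β} (hf : PolyTime A f) : PolyBound fun a => esize (f a) :=
  let ⟨_, P, hP⟩ := hf
  ⟨P, fun a => (hP a).1⟩

theorem id : PolyTime A (fun a : α => a) := FP.id

theorem const (b : β) : PolyTime A (fun _ : α => b) := FP.const _

theorem comp {g : β → γ} (hg : PolyTime A g) {f : α → β} (hf : PolyTime A f) :
    PolyTime A (fun a => g (f a)) := FP.comp (FP.reindex hg f) hf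

theorem pair {f : α → β} {g : α → γ} (hf : PolyTime A f) (hg : PolyTime A g) :
    PolyTime A (fun a => (f a, g a)) := FP.cons hf hg

theorem fst {f : α → β × γ} (hf : PolyTime A f) : PolyTime A (fun a => (f a).1) :=
  FP.comp (FP.hd (e := fun a => rep (f a))) hf

theorem snd {f : α → β × γ} (hf : PolyTime A f) : PolyTime A (fun a => (f a).2) :=
  FP.comp (FP.tl (e := fun a => rep (f a))) hf

theorem cond {p : α → Bool} {f g : α → β} (hp : PolyTime A p) (hf : PolyTime A f)
    (hg : PolyTime A g) : PolyTime A (fun a => bif p a then f a else g a) := by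
  have : (fun a => rep (bif p a then f a else g a)) =
      fun a => match rep (p a) with | .nil => rep (g a) | .cons _ _ => rep (f a) := by
    funext a
    cases p a <;> rfl
  rw [PolyTime, this]
  exact FP.ite hp hf hg

theorem and {p q : α → Bool} (hp : PolyTime A p) (hq : PolyTime A q) :
    PolyTime A (fun a => p a && q a) := by
  convert hp.cond hq (const false) using 2 with a
  cases p a <;> rfl

theorem or {p q : α → Bool} (hp : PolyTime A p) (hq : PolyTime A q) :
    PolyTime A (fun a => p a || q a) := by
  convert hp.cond (const true) hq using 2 with a
  cases p a <;> rfl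

theorem not {p : α → Bool} (hp : PolyTime A p) : PolyTime A (fun a => !p a) := by
  convert hp.cond (const false) (const true) using 2 with a
  cases p a <;> rfl

theorem xor {p q : α → Bool} (hp : PolyTime A p) (hq : PolyTime A q) :
    PolyTime A (fun a => p a ^^ q a) := by
  convert hp.cond hq.not hq using 2 with a
  cases p a <;> simp

theorem cons {f : α → β} {g : α → List β} (hf : PolyTime A f) (hg : PolyTime A g) :
    PolyTime A (fun a => f a :: g a) := FP.cons hf hg

theorem tail {f : α → List β} (hf : PolyTime A f) : PolyTime A (fun a => (f a).tail) := by
  have : (fun a => rep (f a).tail) = fun a => (rep (f a)).tl := by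
    funext a
    cases f a <;> rfl
  rw [PolyTime, this]
  exact FP.comp (FP.tl (e := fun a => rep (f a))) hf

theorem listCases {l : α → List β} {f : α → γ} {g : α → β → List β → γ} (hl : PolyTime A l)
    (hf : PolyTime A f) (hg : PolyTime A fun p : α × β × List β => g p.1 p.2.1 p.2.2) :
    PolyTime A (fun a => listElim (l a) (f a) (g a)) := by
  -- The head of a list needs a default value; if `β` has no element, all lists are empty and no
  -- case distinction is needed.
  obtain b₀ | h := isEmpty_or_nonempty β
  · have : (fun a => listElim (l a) (f a) (g a)) = f := by
      funext a
      cases l a with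
      | nil => rfl
      | cons b t => exact b₀.elim b
    rwa [this]
  obtain ⟨b₀⟩ := h
  let u : α → α × β × List β := fun a => (a, (l a).headD b₀, (l a).tail)
  have hu : PolyTime A u := by
    refine pair id (pair ?_ hl.tail)
    have : (fun a => rep ((l a).headD b₀)) =
        fun a => match rep (l a) with | .nil => rep b₀ | .cons _ _ => (rep (l a)).hd := by
      funext a
      cases l a <;> rfl
    rw [PolyTime, this]
    exact FP.ite hl (FP.comp (FP.hd (e := fun a => rep (l a))) hl) (FP.const _)
  have : (fun a => rep (listElim (l a) (f a) (g a))) =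
      fun a => match rep (l a) with
        | .nil => rep (f a) | .cons _ _ => rep (g (u a).1 (u a).2.1 (u a).2.2) := by
    funext a
    simp only [u]
    cases l a <;> rfl
  rw [PolyTime, this]
  exact FP.ite hl (hg.comp hu) hf

theorem isEmpty {l : α → List β} (hl : PolyTime A l) : PolyTime A (fun a => (l a).isEmpty) := by
  convert hl.listCases (const true) (g := fun _ _ _ => false) (const false) using 2 with a
  cases l a <;> rfl

theorem headD {l : α → List β} {f : α → β} (hl : PolyTime A l) (hf : PolyTime A f) :
    PolyTime A (fun a => (l a).headD (f a)) := by
  convert hl.listCases hf (g := fun _ b _ => b) id.snd.fst using 2 with a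
  cases l a <;> rfl

/-- Folds whose intermediate results are bounded by a polynomial. -/
theorem foldl_of_bound {F : α → σ → β → σ} {l : α → List β} {i : α → σ}
    (hF : PolyTime A fun p : α × σ × β => F p.1 p.2.1 p.2.2) (hl : PolyTime A l)
    (hi : PolyTime A i) {B : α → ℕ} (hB : PolyBound B)
    (h : ∀ a, ∀ k ≤ (l a).length, esize (((l a).take k).foldl (F a) (i a)) ≤ B a) :
    PolyTime A (fun a => (l a).foldl (F a) (i a)) := by
  -- The fold is an iteration on triples (parameter, remaining list, state), and the list itself
  -- counts the rounds.
  let u : α × List β × σ → α × List β × σ := fun p =>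
    (p.1, p.2.1.tail, listElim p.2.1 p.2.2 fun b _ => F p.1 p.2.2 b)
  have hu : PolyTime A u := by
    refine pair id.fst (pair id.snd.fst.tail (listCases (g := fun p b _ => F p.1 p.2.2 b)
      id.snd.fst id.snd.snd ?_))
    exact hF.comp (pair id.fst.fst (pair id.fst.snd.snd id.snd.fst))
  have hk : ∀ (k : ℕ) (a : α) (l : List β) (s : σ),
      u^[k] (a, l, s) = (a, l.drop k, (l.take k).foldl (F a) s) := by
    intro k
    induction k with
    | zero => simp
    | succ k ih =>
      intro a l s
      rw [Function.iterate_succ_apply]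
      cases l with
      | nil => simp [u, ih]
      | cons b l => simp [u, ih]
  obtain ⟨Q, hQ⟩ := (PolyBound.esize.add (hl.bound.add hB)).add (PolyBound.const 2)
  have key := FP.iterate (A := A) (e := fun a : α => rep a) hu hl
    (x := fun a => (a, l a, i a)) (pair id (pair hl hi)) Q ?_
  · have : (fun a => rep (u^[(rep (l a)).len] (a, l a, i a))) =
        fun a => rep (a, ([] : List β), (l a).foldl (F a) (i a)) := by
      funext a
      rw [hk, len_rep]
      simp
    rw [this] at key
    exact snd (snd (f := fun a => (a, ([] : List β), (l a).foldl (F a) (i a))) key)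
  · intro a k hka
    rw [len_rep] at hka
    refine le_trans ?_ (hQ a)
    have h1 := h a k hka
    have h2 := esize_drop_le (l a) k
    rw [hk]
    change esize (_, _, _) ≤ _
    simp only [esize_pair]
    omega

/-- Growth by at most `Q a` in each round keeps the measure polynomial, as the number of rounds is
at most the size of the list. A separate measure `μ` is useful when additive growth is easier to see
for it than for the size, for instance for the number of digits. -/
theorem foldl_of_measure {F : α → σ → β → σ} {l : α → List β} {i : α → σ}
    (hF : PolyTime A fun p : α × σ × β => F p.1 p.2.1 p.2.2) (hl : PolyTime A l)
    (hi : PolyTime A i) (μ : α → σ → ℕ) (R : Polynomial ℕ)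
    (hR : ∀ a s, esize s ≤ R.eval (μ a s)) {Q : α → ℕ} (hQ : PolyBound Q)
    (h0 : ∀ a, μ a (i a) ≤ Q a) (h1 : ∀ a s, ∀ b ∈ l a, μ a (F a s b) ≤ μ a s + Q a) :
    PolyTime A (fun a => (l a).foldl (F a) (i a)) := by
  refine foldl_of_bound hF hl hi (((hl.bound.mul hQ).add hQ).eval R) fun a k hk => ?_
  refine (hR a _).trans (eval_mono R ?_)
  have key : ∀ (t : List β) (s : σ), (∀ b ∈ t, b ∈ l a) →
      μ a (t.foldl (F a) s) ≤ t.length * Q a + μ a s := by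
    intro t
    induction t with
    | nil => simp
    | cons b t ih =>
      intro s hs
      have e1 := ih (F a s b) fun b hb => hs b (by simp [hb])
      have e2 := h1 a s b (hs b (by simp))
      simp only [List.foldl_cons, List.length_cons, add_mul]
      omega
  have e1 := key ((l a).take k) (i a) fun b hb => List.mem_of_mem_take hb
  have e2 : ((l a).take k).length ≤ esize (l a) :=
    (List.length_take_le' _ _).trans (length_le_esize _)
  exact e1.trans (add_le_add (Nat.mul_le_mul_right _ e2) (h0 a))

theorem foldl_of_add {F : α → σ → β → σ} {l : α → List β} {i : α → σ}
    (hF : PolyTime A fun p : α × σ × β => F p.1 p.2.1 p.2.2) (hl : PolyTime A l)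
    (hi : PolyTime A i) {Q : α → ℕ} (hQ : PolyBound Q)
    (h1 : ∀ a s, ∀ b ∈ l a, esize (F a s b) ≤ esize s + Q a) :
    PolyTime A (fun a => (l a).foldl (F a) (i a)) :=
  foldl_of_measure hF hl hi (fun _ s => esize s) Polynomial.X (by simp) (hi.bound.add hQ)
    (fun _ => Nat.le_add_right _ _) fun a s b hb => (h1 a s b hb).trans (by omega)

theorem reverse {l : α → List β} (hl : PolyTime A l) : PolyTime A (fun a => (l a).reverse) := by
  have := foldl_of_add (A := A) (F := fun (_ : α) (s : List β) b => b :: s) (l := l)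
    (i := fun _ => []) (cons id.snd.snd id.snd.fst) hl (const _)
    (hl.bound.add (PolyBound.const 1))
    (fun a s b hb => by have := esize_le_of_mem hb; simp only [esize_cons]; omega)
  convert this using 2 with a
  rw [List.foldl_flip_cons_eq_append']
  simp

theorem foldr_of_measure {F : α → β → σ → σ} {l : α → List β} {i : α → σ}
    (hF : PolyTime A fun p : α × β × σ => F p.1 p.2.1 p.2.2) (hl : PolyTime A l)
    (hi : PolyTime A i) (μ : α → σ → ℕ) (R : Polynomial ℕ)
    (hR : ∀ a s, esize s ≤ R.eval (μ a s)) {Q : α → ℕ} (hQ : PolyBound Q)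
    (h0 : ∀ a, μ a (i a) ≤ Q a) (h1 : ∀ a s, ∀ b ∈ l a, μ a (F a b s) ≤ μ a s + Q a) :
    PolyTime A (fun a => (l a).foldr (F a) (i a)) := by
  have := foldl_of_measure (A := A) (F := fun a s b => F a b s)
    (hF.comp (pair id.fst (pair id.snd.snd id.snd.fst))) hl.reverse hi μ R hR hQ h0
    (fun a s b hb => h1 a s b (List.mem_reverse.1 hb))
  simpa only [List.foldl_reverse] using this

theorem foldr_of_add {F : α → β → σ → σ} {l : α → List β} {i : α → σ}
    (hF : PolyTime A fun p : α × β × σ => F p.1 p.2.1 p.2.2) (hl : PolyTime A l)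
    (hi : PolyTime A i) {Q : α → ℕ} (hQ : PolyBound Q)
    (h1 : ∀ a s, ∀ b ∈ l a, esize (F a b s) ≤ esize s + Q a) :
    PolyTime A (fun a => (l a).foldr (F a) (i a)) := by
  have := foldl_of_add (A := A) (F := fun a s b => F a b s)
    (hF.comp (pair id.fst (pair id.snd.snd id.snd.fst))) hl.reverse hi hQ
    (fun a s b hb => h1 a s b (List.mem_reverse.1 hb))
  simpa only [List.foldl_reverse] using this

theorem map {f : α → β → γ} {l : α → List β} (hl : PolyTime A l)
    (hf : PolyTime A fun p : α × β => f p.1 p.2) : PolyTime A (fun a => (l a).map (f a)) := by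
  obtain ⟨P, hP⟩ := hf.bound
  have := foldr_of_add (A := A) (F := fun a b (s : List γ) => f a b :: s) (l := l)
    (i := fun _ => []) (cons (hf.comp (pair id.fst id.snd.fst)) id.snd.snd) hl (const _)
    (((((PolyBound.esize.add hl.bound).add (PolyBound.const 1)).eval P)).add (PolyBound.const 1))
    (fun a s b hb => by
      have h1 := esize_le_of_mem hb
      have h2 := (hP (a, b)).trans (eval_mono P (b := esize a + esize (l a) + 1) (by simpa))
      simp only [esize_cons]
      dsimp only at h2
      omega)
  simpa only [List.foldr_cons_eq_append, List.append_nil] using this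

theorem all {p : α → β → Bool} {l : α → List β} (hl : PolyTime A l)
    (hp : PolyTime A fun q : α × β => p q.1 q.2) : PolyTime A (fun a => (l a).all (p a)) := by
  have := foldr_of_add (A := A) (F := fun a b s => p a b && s) (l := l) (i := fun _ => true)
    (and (hp.comp (pair id.fst id.snd.fst)) id.snd.snd) hl (const _) (PolyBound.const 3)
    (fun a s b hb => (esize_bool _).trans (by omega))
  convert this using 2 with a
  induction l a with
  | nil => rfl
  | cons b l ih => simp [ih]

theorem any {p : α → β → Bool} {l : α → List β} (hl : PolyTime A l)
    (hp : PolyTime A fun q : α × β => p q.1 q.2) : PolyTime A (fun a => (l a).any (p a)) := by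
  convert (hl.all (p := fun a b => !p a b) hp.not).not using 2 with a
  exact List.any_eq_not_all_not

theorem append {l l' : α → List β} (hl : PolyTime A l) (hl' : PolyTime A l') :
    PolyTime A (fun a => l a ++ l' a) := by
  have := foldr_of_add (A := A) (F := fun _ b (s : List β) => b :: s) (l := l) (i := l')
    (cons id.snd.fst id.snd.snd) hl hl' (hl.bound.add (PolyBound.const 1))
    (fun a s b hb => by have := esize_le_of_mem hb; simp only [esize_cons]; omega)
  convert this using 2 with a
  induction l a with
  | nil => rfl
  | cons b t ih => exact congrArg (b :: ·) ih

theorem flatten {l : α → List (List β)} (hl : PolyTime A l) :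
    PolyTime A (fun a => (l a).flatten) := by
  have := foldr_of_add (A := A) (F := fun _ b (s : List β) => b ++ s) (l := l) (i := fun _ => [])
    (append id.snd.fst id.snd.snd) hl (const _) hl.bound
    (fun a s b hb => by
      have := esize_le_of_mem hb
      have := esize_append b s
      omega)
  convert this using 2 with a
  induction l a with
  | nil => rfl
  | cons b t ih => simp [ih]

theorem flatMap {f : α → β → List γ} {l : α → List β} (hl : PolyTime A l)
    (hf : PolyTime A fun p : α × β => f p.1 p.2) : PolyTime A (fun a => (l a).flatMap (f a)) :=
  (hl.map hf).flatten

theorem zip {l : α → List β} {l' : α → List γ} (hl : PolyTime A l) (hl' : PolyTime A l') :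
    PolyTime A (fun a => (l a).zip (l' a)) := by
  -- The state consists of the unused part of the second list and the pairs found so far, in reverse
  -- order.
  let F : List γ × List (β × γ) → β → List γ × List (β × γ) := fun s b =>
    listElim s.1 s fun c t => (t, (b, c) :: s.2)
  have key : ∀ (l : List β) (l' : List γ) (r : List (β × γ)),
      (l.foldl F (l', r)).2 = (l.zip l').reverse ++ r := by
    intro l
    induction l with
    | nil => simp
    | cons b l ih =>
      intro l' r
      cases l' with
      | nil =>
        have : ∀ l : List β, l.foldl F ([], r) = ([], r) := by
          intro l
          induction l with
          | nil => rfl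
          | cons b l ih => exact ih
        rw [this]
        simp
      | cons c t => simp [F, ih]
  have := foldl_of_add (A := A) (F := fun _ => F) (l := l) (i := fun a => (l' a, []))
    (listCases (l := fun p : α × (List γ × List (β × γ)) × β => p.2.1.1) (f := fun p => p.2.1)
      (g := fun p c t => (t, (p.2.2, c) :: p.2.1.2)) id.snd.fst.fst id.snd.fst
      (pair id.snd.snd (cons (pair id.fst.snd.snd id.snd.fst) id.fst.snd.fst.snd)))
    hl (pair hl' (const _)) (hl.bound.add (PolyBound.const 2))
    (fun a s b hb => by
      have := esize_le_of_mem hb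
      obtain ⟨s, r⟩ := s
      cases s with
      | nil => exact Nat.le_add_right _ _
      | cons c t => simp only [F, listElim_cons, esize_pair, esize_cons]; omega)
  convert this.snd.reverse using 2 with a
  rw [key]
  simp

theorem sexpHd {f : α → Sexp} (hf : PolyTime A f) : PolyTime A (fun a => (f a).hd) :=
  FP.comp (FP.hd (e := fun a => f a)) hf

theorem sexpTl {f : α → Sexp} (hf : PolyTime A f) : PolyTime A (fun a => (f a).tl) :=
  FP.comp (FP.tl (e := fun a => f a)) hf

theorem sexpCons {f g : α → Sexp} (hf : PolyTime A f) (hg : PolyTime A g) :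
    PolyTime A (fun a => Sexp.cons (f a) (g a)) := FP.cons hf hg

end PolyTime

namespace Sexp

/-- Every S-expression is a list of S-expressions. -/
def toList : Sexp → List Sexp
  | nil => []
  | cons a b => a :: b.toList

theorem rep_toList (t : Sexp) : HasRep.rep t.toList = t := by
  induction t with
  | nil => rfl
  | cons a b _ ih =>
    rw [toList]
    exact congrArg (Sexp.cons a) ih

theorem toList_rep {α : Type} [HasRep α] (l : List α) :
    (HasRep.rep l).toList = l.map HasRep.rep := by
  induction l with
  | nil => rfl
  | cons a l ih => exact congrArg (HasRep.rep a :: ·) ih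

def toBool : Sexp → Bool
  | nil => false
  | cons _ _ => true

@[simp] theorem toBool_rep (b : Bool) : (HasRep.rep b).toBool = b := by cases b <;> rfl

end Sexp

namespace PolyTime
variable {A : Language Bool} {α : Type} [HasRep α]

theorem sexpToList {f : α → Sexp} (hf : PolyTime A f) : PolyTime A (fun a => (f a).toList) := by
  have : (fun a => rep (f a).toList) = fun a => rep (f a) := funext fun a => rep_toList _
  rw [PolyTime, this]
  exact hf

theorem sexpToBool {f : α → Sexp} (hf : PolyTime A f) : PolyTime A (fun a => (f a).toBool) := by
  have : (fun a => rep (f a).toBool) =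
      fun a => match rep (f a) with | .nil => rep false | .cons _ _ => rep true := by
    funext a
    change rep (f a).toBool = match f a with | .nil => rep false | .cons _ _ => rep true
    cases f a <;> rfl
  rw [PolyTime, this]
  exact FP.ite hf (FP.const _) (FP.const _)

end PolyTime

end Complexity

/-! ### Arithmetic in polynomial time -/

namespace Complexity

open Sexp HasRep

/-- The number with the given binary digits, the least significant one first. -/
def natOfBits (l : List Bool) : ℕ := l.foldr Nat.bit 0

@[simp] theorem natOfBits_nil : natOfBits [] = 0 := rfl

theorem natOfBits_cons (b : Bool) (l : List Bool) :
    natOfBits (b :: l) = 2 * natOfBits l + b.toNat := Nat.bit_val _ _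

theorem natOfBits_append (l l' : List Bool) :
    natOfBits (l ++ l') = natOfBits l + 2 ^ l.length * natOfBits l' := by
  induction l with
  | nil => simp
  | cons b l ih =>
    rw [List.cons_append, natOfBits_cons, ih, natOfBits_cons, List.length_cons, pow_succ]
    ring

@[simp] theorem natOfBits_bits (n : ℕ) : natOfBits n.bits = n := by
  induction n using Nat.binaryRec' with
  | zero => simp
  | bit b n h ih =>
    rw [Nat.bits_append_bit _ _ h, natOfBits_cons, ih, Nat.bit_val]

/-- The digit of highest order comes last; the hypothesis excludes a leading zero, the only source
of ambiguity. -/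
theorem bits_natOfBits (l : List Bool) (h : l.getLast? ≠ some false) :
    (natOfBits l).bits = l := by
  induction l with
  | nil => simp
  | cons b l ih =>
    have h1 : l.getLast? ≠ some false := by
      cases l with
      | nil => simp
      | cons c l => simpa using h
    have h2 : natOfBits l = 0 → b = true := by
      intro h0
      have e := ih h1
      rw [h0] at e
      rw [← e] at h
      simpa using h
    have : natOfBits (b :: l) = Nat.bit b (natOfBits l) := rfl
    rw [this, Nat.bits_append_bit _ _ h2, ih h1]

theorem esize_bits_le (l : List Bool) : esize l ≤ 4 * l.length + 1 :=
  (esize_list_le l 3 fun b _ => esize_bool b).trans (by omega)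

theorem esize_nat_le (n : ℕ) : esize n ≤ 4 * n.size + 1 := by
  rw [← Nat.size_eq_bits_len]
  exact esize_bits_le n.bits

theorem size_le_esize (n : ℕ) : n.size ≤ esize n := by
  rw [← Nat.size_eq_bits_len]
  exact length_le_esize n.bits

theorem size_le_self (n : ℕ) : n.size ≤ n := Nat.size_le.2 Nat.lt_two_pow_self

theorem esize_div2_le (n : ℕ) : esize n.div2 ≤ esize n := by
  change esize n.div2.bits ≤ esize n.bits
  rw [Nat.div2_bits_eq_tail, ← List.drop_one]
  exact esize_drop_le _ _

namespace PolyTime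
variable {A : Language Bool} {α β γ : Type} [HasRep α] [HasRep β] [HasRep γ]

theorem natBits {f : α → ℕ} (hf : PolyTime A f) : PolyTime A (fun a => (f a).bits) := hf

theorem of_natBits {f : α → ℕ} (hf : PolyTime A (fun a => (f a).bits)) : PolyTime A f := hf

theorem bodd {f : α → ℕ} (hf : PolyTime A f) : PolyTime A (fun a => (f a).bodd) := by
  convert (natBits hf).headD (const false) using 2 with a
  rw [Nat.bodd_eq_bits_head]
  cases (f a).bits <;> rfl

theorem div2 {f : α → ℕ} (hf : PolyTime A f) : PolyTime A (fun a => (f a).div2) := by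
  apply of_natBits
  simp only [Nat.div2_bits_eq_tail]
  exact (natBits hf).tail

theorem bit {b : α → Bool} {f : α → ℕ} (hb : PolyTime A b) (hf : PolyTime A f) :
    PolyTime A (fun a => Nat.bit (b a) (f a)) := by
  apply of_natBits
  convert ((hb.not.and (natBits hf).isEmpty).cond (const []) (hb.cons (natBits hf))) using 2 with a
  -- The digit 0 attached to the number 0 must not create a leading zero.
  by_cases h : f a = 0 ∧ b a = false
  · simp [h.1, h.2]
  · have e : f a = 0 → b a = true := by simpa using h
    rw [Nat.bits_append_bit _ _ e]
    cases hb : b a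
    · have : (f a).bits ≠ [] := by
        intro e'
        have h0 : f a = 0 := by rw [← natOfBits_bits (f a), e', natOfBits_nil]
        exact h ⟨h0, hb⟩
      cases h : (f a).bits with
      | nil => exact absurd h this
      | cons c t => simp
    · simp

theorem natOfBits {l : α → List Bool} (hl : PolyTime A l) :
    PolyTime A (fun a => natOfBits (l a)) := by
  refine foldr_of_add (F := fun _ b n => Nat.bit b n) (i := fun _ => 0)
    (bit id.snd.fst id.snd.snd) hl (const _) (PolyBound.const 4) fun a n b _ => ?_
  by_cases h : n = 0 → b = true
  · change Complexity.esize (Nat.bit b n).bits ≤ Complexity.esize n.bits + 4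
    have := esize_bool b
    rw [Nat.bits_append_bit _ _ h]
    simp only [esize_cons]
    omega
  · simp only [Classical.not_imp, Bool.not_eq_true] at h
    simp [h.1, h.2]

/-- One step of the addition of two numbers, digit by digit; the state consists of the remaining
digits, the carry, and the digits of the sum found so far. -/
def addStep (s : (ℕ × ℕ) × Bool × List Bool) : (ℕ × ℕ) × Bool × List Bool :=
  ((s.1.1.div2, s.1.2.div2),
    (bif s.1.1.bodd ^^ s.1.2.bodd then s.2.1 else s.1.1.bodd),
    (s.1.1.bodd ^^ s.1.2.bodd ^^ s.2.1) :: s.2.2)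

/-- The invariant of addition by hand: the digits found, plus the two remaining numbers and the
carry at the current power of two, keep the same total. If the two digits differ, the carry is
passed on; otherwise the new carry is their common value. -/
theorem addStep_iterate (t : List Bool) : ∀ s : (ℕ × ℕ) × Bool × List Bool,
    let s' := t.foldl (fun s _ => addStep s) s
    s'.1.1 = s.1.1 / 2 ^ t.length ∧ s'.1.2 = s.1.2 / 2 ^ t.length ∧
    Complexity.natOfBits s'.2.2.reverse + 2 ^ s'.2.2.length * (s'.1.1 + s'.1.2 + s'.2.1.toNat) =
      Complexity.natOfBits s.2.2.reverse + 2 ^ s.2.2.length * (s.1.1 + s.1.2 + s.2.1.toNat) := by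
  induction t with
  | nil => intro s; simp
  | cons b t ih =>
    rintro ⟨⟨x, y⟩, c, out⟩
    obtain ⟨h1, h2, h3⟩ := ih (addStep ((x, y), c, out))
    refine ⟨?_, ?_, ?_⟩
    · rw [List.foldl_cons, h1, List.length_cons, pow_succ', ← Nat.div_div_eq_div_mul]
      simp [addStep, Nat.div2_val]
    · rw [List.foldl_cons, h2, List.length_cons, pow_succ', ← Nat.div_div_eq_div_mul]
      simp [addStep, Nat.div2_val]
    · rw [List.foldl_cons, h3]
      have hx := Nat.bodd_add_div2 x
      have hy := Nat.bodd_add_div2 y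
      simp only [addStep, List.reverse_cons, natOfBits_append, List.length_reverse,
        List.length_cons, natOfBits_cons, natOfBits_nil, pow_succ]
      have key : 2 * (x.div2 + y.div2 + (bif x.bodd ^^ y.bodd then c else x.bodd).toNat) +
          (x.bodd ^^ y.bodd ^^ c).toNat = x + y + c.toNat := by
        generalize x.bodd = p at *
        generalize y.bodd = q at *
        cases p <;> cases q <;> cases c <;> simp at hx hy ⊢ <;> omega
      rw [← key]
      ring

theorem add {f g : α → ℕ} (hf : PolyTime A f) (hg : PolyTime A g) :
    PolyTime A (fun a => f a + g a) := by
  -- The list of all digits serves only as a clock, long enough to exhaust both numbers. The last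
  -- carry is later added as the leading digit.
  have h1 := foldl_of_measure (A := A) (F := fun (_ : α) s (_ : Bool) => addStep s)
    (l := fun a => (f a).bits ++ (g a).bits) (i := fun a => ((f a, g a), false, []))
    (by
      have hs : PolyTime A fun p : α × ((ℕ × ℕ) × Bool × List Bool) × Bool => p.2.1 := id.snd.fst
      exact pair (pair hs.fst.fst.div2 hs.fst.snd.div2)
        (pair ((hs.fst.fst.bodd.xor hs.fst.snd.bodd).cond hs.snd.fst hs.fst.fst.bodd)
          (((hs.fst.fst.bodd.xor hs.fst.snd.bodd).xor hs.snd.fst).cons hs.snd.snd)))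
    ((natBits hf).append (natBits hg)) (pair (pair hf hg) (const _))
    (fun _ s => Complexity.esize s.1 + Complexity.esize s.2.2) (Polynomial.X + 5)
    (fun _ s => by
      have := esize_bool s.2.1
      simp only [esize_pair, Polynomial.eval_add, Polynomial.eval_X, Polynomial.eval_ofNat] at *
      omega)
    ((hf.bound.add hg.bound).add (PolyBound.const 5))
    (fun a => by simp only [esize_pair, esize_nil]; omega)
    (fun a s b _ => by
      have h1 := esize_bool (s.1.1.bodd ^^ s.1.2.bodd ^^ s.2.1)
      have h2 := esize_div2_le s.1.1
      have h3 := esize_div2_le s.1.2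
      simp only [addStep, esize_pair, esize_cons] at *
      omega)
  convert natOfBits (h1.snd.fst.cons h1.snd.snd).reverse using 2 with a
  obtain ⟨e1, e2, e3⟩ := addStep_iterate ((f a).bits ++ (g a).bits) ((f a, g a), false, [])
  have l2 : f a < 2 ^ ((f a).bits ++ (g a).bits).length :=
    (Nat.lt_size_self _).trans_le (Nat.pow_le_pow_right (by norm_num)
      (by simp [← Nat.size_eq_bits_len]))
  have l3 : g a < 2 ^ ((f a).bits ++ (g a).bits).length :=
    (Nat.lt_size_self _).trans_le (Nat.pow_le_pow_right (by norm_num)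
      (by simp [← Nat.size_eq_bits_len]))
  rw [Nat.div_eq_of_lt l2] at e1
  rw [Nat.div_eq_of_lt l3] at e2
  rw [e1, e2] at e3
  simp only [List.reverse_cons, natOfBits_append, List.length_reverse, natOfBits_cons,
    natOfBits_nil]
  simp at e3
  simp
  omega

theorem double {f : α → ℕ} (hf : PolyTime A f) : PolyTime A (fun a => 2 * f a) := by
  convert bit (const false) hf using 2 with a
  simp [Nat.bit_val]

/-- Horner's scheme on the digits of the second factor, from the leading one down. The measure is
the number of digits, with that of `f a` as a floor, so that doubling and adding `f a` lengthens it
by at most 2. -/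
theorem mul {f g : α → ℕ} (hf : PolyTime A f) (hg : PolyTime A g) :
    PolyTime A (fun a => f a * g a) := by
  have h := foldr_of_measure (A := A) (F := fun a b n => 2 * n + bif b then f a else 0)
    (l := fun a => (g a).bits) (i := fun _ => 0)
    (add (double id.snd.snd) (cond id.snd.fst (hf.comp id.fst) (const 0)))
    (natBits hg) (const 0) (fun a n => max n.size (f a).size) (4 * Polynomial.X + 1)
    (fun a n => (esize_nat_le n).trans (by simp))
    (hf.bound.add (PolyBound.const 2))
    (fun a => by have := size_le_esize (f a); simp; omega)
    (fun a n b _ => by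
      have h1 : n < 2 ^ max n.size (f a).size :=
        (Nat.lt_size_self _).trans_le (Nat.pow_le_pow_right (by norm_num) (le_max_left _ _))
      have h2 : f a < 2 ^ max n.size (f a).size :=
        (Nat.lt_size_self _).trans_le (Nat.pow_le_pow_right (by norm_num) (le_max_right _ _))
      have h3 : (2 * n + bif b then f a else 0).size ≤ max n.size (f a).size + 2 := by
        rw [Nat.size_le, pow_add]
        cases b <;> simp only [cond_true, cond_false] <;> omega
      omega)
  convert h using 2 with a
  have key : ∀ l : List Bool, l.foldr (fun b n => 2 * n + bif b then f a else 0) 0 =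
      f a * Complexity.natOfBits l := by
    intro l
    induction l with
    | nil => simp
    | cons b l ih =>
      rw [List.foldr_cons, ih, natOfBits_cons]
      cases b <;> simp <;> ring
  rw [key, natOfBits_bits]

/-- One step of the comparison of two numbers, digit by digit. -/
def leStep (s : (ℕ × ℕ) × Bool) : (ℕ × ℕ) × Bool :=
  ((s.1.1.div2, s.1.2.div2), bif s.1.1.bodd ^^ s.1.2.bodd then s.1.2.bodd else s.2)

/-- Digits are read from the lowest one up, so the last position where they differ decides; `r` is
the verdict on the digits already read. -/
theorem leStep_iterate (t : List Bool) : ∀ x y : ℕ, ∀ r : Bool, x < 2 ^ t.length →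
    y < 2 ^ t.length → ((t.foldl (fun s _ => leStep s) ((x, y), r)).2 = true ↔
      x < y ∨ x = y ∧ r = true) := by
  induction t with
  | nil =>
    intro x y r hx hy
    simp at hx hy
    simp [hx, hy]
  | cons b t ih =>
    intro x y r hx hy
    have ex := Nat.bodd_add_div2 x
    have ey := Nat.bodd_add_div2 y
    have lx := Bool.toNat_le x.bodd
    have ly := Bool.toNat_le y.bodd
    rw [List.length_cons, pow_succ] at hx hy
    rw [List.foldl_cons]
    refine (ih x.div2 y.div2 _ (by omega) (by omega)).trans ?_
    dsimp only
    generalize x.bodd = p at *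
    generalize y.bodd = q at *
    cases p <;> cases q <;> cases r <;> simp at ex ey ⊢ <;> omega

theorem le {f g : α → ℕ} (hf : PolyTime A f) (hg : PolyTime A g) :
    PolyTime A (fun a => decide (f a ≤ g a)) := by
  have h1 := foldl_of_measure (A := A) (F := fun (_ : α) s (_ : Bool) => leStep s)
    (l := fun a => (f a).bits ++ (g a).bits) (i := fun a => ((f a, g a), true))
    (by
      have hs : PolyTime A fun p : α × ((ℕ × ℕ) × Bool) × Bool => p.2.1 := id.snd.fst
      exact pair (pair hs.fst.fst.div2 hs.fst.snd.div2)
        ((hs.fst.fst.bodd.xor hs.fst.snd.bodd).cond hs.fst.snd.bodd hs.snd))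
    ((natBits hf).append (natBits hg)) (pair (pair hf hg) (const _))
    (fun _ s => Complexity.esize s.1) (Polynomial.X + 4)
    (fun _ s => by
      have := esize_bool s.2
      simp only [esize_pair, Polynomial.eval_add, Polynomial.eval_X, Polynomial.eval_ofNat] at *
      omega)
    ((hf.bound.add hg.bound).add (PolyBound.const 5))
    (fun a => by simp only [esize_pair]; omega)
    (fun a s b _ => by
      have h2 := esize_div2_le s.1.1
      have h3 := esize_div2_le s.1.2
      simp only [leStep, esize_pair] at *
      omega)
  convert h1.snd using 2 with a
  rw [Bool.eq_iff_iff, decide_eq_true_eq, leStep_iterate]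
  · simp [le_iff_lt_or_eq]
  all_goals exact (Nat.lt_size_self _).trans_le (Nat.pow_le_pow_right (by norm_num)
      (by simp [← Nat.size_eq_bits_len]))

theorem natEq {f g : α → ℕ} (hf : PolyTime A f) (hg : PolyTime A g) :
    PolyTime A (fun a => decide (f a = g a)) := by
  convert (hf.le hg).and (hg.le hf) using 2 with a
  rw [Bool.eq_iff_iff]
  simp [le_antisymm_iff]

theorem bitsEq {f g : α → List Bool} (hf : PolyTime A f) (hg : PolyTime A g) :
    PolyTime A (fun a => decide (f a = g a)) := by
  -- A final digit 1 rules out leading zeros, so equality of lists becomes equality of numbers.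
  convert (natOfBits (hf.append (const [true]))).natEq
    (natOfBits (hg.append (const [true]))) using 2 with a
  rw [decide_eq_decide]
  refine ⟨fun h => by rw [h], fun h => ?_⟩
  have := congrArg Nat.bits h
  rw [bits_natOfBits _ (by simp), bits_natOfBits _ (by simp)] at this
  exact List.append_cancel_right this

theorem length {l : α → List β} (hl : PolyTime A l) : PolyTime A (fun a => (l a).length) := by
  have := foldl_of_measure (A := A) (F := fun (_ : α) n (_ : β) => n + 1) (l := l)
    (i := fun _ => 0) (add id.snd.fst (const 1)) hl (const 0) (fun _ n => n)
    (4 * Polynomial.X + 1)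
    (fun _ n => by have := esize_nat_le n; have := size_le_self n; simp; omega)
    (PolyBound.const 1) (by simp) (by simp)
  convert this using 2 with a
  simp

theorem range {l : α → List β} (hl : PolyTime A l) :
    PolyTime A (fun a => List.range (l a).length) := by
  -- The range is built in decreasing order: the length of the list so far is the next element.
  have key : ∀ (l : List β) (k : ℕ), l.foldl (fun s _ => s.length :: s)
      (List.range k).reverse = (List.range (k + l.length)).reverse := by
    intro l
    induction l with
    | nil => simp
    | cons b l ih =>
      intro k
      have := ih (k + 1)
      rw [List.range_succ] at this
      simp at this
      simp [this, Nat.add_comm, Nat.add_left_comm]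
  have := foldl_of_bound (A := A) (F := fun (_ : α) (s : List ℕ) (_ : β) => s.length :: s)
    (l := l) (i := fun _ => (List.range 0).reverse)
    (cons (length id.snd.fst) id.snd.fst) hl (const _)
    ((hl.bound.mul (((PolyBound.const 4).mul hl.bound).add (PolyBound.const 2))).add
      (PolyBound.const 1))
    (fun a k hk => by
      have h1 : ((l a).take k).length ≤ Complexity.esize (l a) :=
        (List.length_take_le' _ _).trans (length_le_esize _)
      rw [key, esize_reverse]
      refine (esize_list_le _ (4 * Complexity.esize (l a) + 1) fun i hi => ?_).trans ?_
      · have := esize_nat_le i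
        have := size_le_self i
        rw [List.mem_range] at hi
        omega
      · rw [List.length_range]
        have := Nat.mul_le_mul_right (4 * Complexity.esize (l a) + 2) h1
        simpa using this)
  convert this.reverse using 2 with a
  rw [key]
  simp

end PolyTime

end Complexity

/-! ### Decoding of bit strings -/

namespace Complexity

open Sexp HasRep

/-- Types into which every S-expression can be read in polynomial time. -/
class Readable (α : Type) [HasRep α] where
  read : Sexp → α
  read_rep : ∀ a, read (rep a) = a
  polyTime : ∀ A, PolyTime A read

open Readable

instance : Readable Bool where
  read := toBool
  read_rep := toBool_rep
  polyTime _ := PolyTime.id.sexpToBool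

instance {α β : Type} [HasRep α] [HasRep β] [Readable α] [Readable β] : Readable (α × β) where
  read t := (read t.hd, read t.tl)
  read_rep _ := Prod.ext (read_rep _) (read_rep _)
  polyTime A := ((polyTime A).comp PolyTime.id.sexpHd).pair ((polyTime A).comp PolyTime.id.sexpTl)

instance {α : Type} [HasRep α] [Readable α] : Readable (List α) where
  read t := t.toList.map read
  read_rep l := by
    rw [toList_rep, List.map_map]
    exact (List.map_congr_left fun a _ => read_rep a).trans (List.map_id l)
  polyTime A := PolyTime.id.sexpToList.map (f := fun _ t => read t)
    ((polyTime A).comp PolyTime.id.snd)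

instance : Readable ℕ where
  read t := natOfBits (read t)
  read_rep n := by
    have : (rep n : Sexp) = rep n.bits := rfl
    rw [this, read_rep, natOfBits_bits]
  polyTime A := (polyTime A).natOfBits

/-! ### Reading codes and pairs -/

/-- One step of the evaluation of Polish notation, from right to left. -/
def decodeStep (b : Bool) (s : List Sexp) : List Sexp :=
  bif b then listElim s s fun x t => listElim t s fun y u => Sexp.cons x y :: u
  else Sexp.nil :: s

/-- The S-expression with a given code. -/
def decode (l : List Bool) : Sexp := (l.foldr decodeStep []).headD Sexp.nil

theorem foldr_decodeStep (t : Sexp) (l : List Bool) :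
    (t.enc ++ l).foldr decodeStep [] = t :: l.foldr decodeStep [] := by
  induction t generalizing l with
  | nil => rfl
  | cons a b iha ihb =>
    rw [enc_cons_append, List.foldr_cons, iha, ihb]
    rfl

theorem decode_enc (t : Sexp) : decode t.enc = t := by
  have := foldr_decodeStep t []
  rw [List.append_nil] at this
  rw [decode, this]
  rfl

/-- One step of the inversion of `pair`. -/
def unpairStep (s : List Bool × List Bool) : List Bool × List Bool :=
  listElim s.2 s fun b t => bif b then listElim t s fun c u => (c :: s.1, u) else s

/-- The inverse of `pair`. -/
def unpair (l : List Bool) : List Bool × List Bool :=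
  let s := l.foldl (fun s _ => unpairStep s) ([], l)
  (s.1.reverse, s.2.tail)

theorem unpair_pair (x y : List Bool) : unpair (pair x y) = (x, y) := by
  -- The list `l` is a clock with at least as many ticks as `x` has bits; once the terminating zero
  -- is on top, the state no longer changes.
  have key : ∀ (x : List Bool) (l : List Bool) (z : List Bool), x.length ≤ l.length →
      l.foldl (fun s _ => unpairStep s) (z, pair x y) = (x.reverse ++ z, false :: y) := by
    intro x l
    induction l generalizing x with
    | nil =>
      intro z h
      have : x = [] := List.length_eq_zero_iff.1 (by simpa using h)
      subst this
      rfl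
    | cons b l ih =>
      intro z h
      cases x with
      | nil => exact ih [] z (by simp)
      | cons a x =>
        have : unpairStep (z, pair (a :: x) y) = (a :: z, pair x y) := rfl
        rw [List.foldl_cons, this, ih x _ (by simpa using h)]
        simp
  have hl : x.length ≤ (pair x y).length := by
    have : ∀ x : List Bool, x.length ≤ (FairDivision.delimit x).length := by
      intro x
      induction x with
      | nil => simp
      | cons a x ih =>
        simp only [FairDivision.delimit, List.flatMap_cons, List.length_append,
          List.length_cons] at ih ⊢
        omega
    rw [pair, List.length_append]
    exact (this x).trans (Nat.le_add_right _ _)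
  rw [unpair, key x _ [] hl]
  simp

namespace PolyTime
variable {A : Language Bool} {α : Type} [HasRep α]

theorem decode {l : α → List Bool} (hl : PolyTime A l) : PolyTime A (fun a => decode (l a)) := by
  refine (foldr_of_add (F := fun _ b s => decodeStep b s) (i := fun _ => []) ?_ hl (const _)
    (PolyBound.const 2) ?_).headD (const _)
  · exact cond id.snd.fst (listCases id.snd.snd id.snd.snd (listCases id.snd.snd id.fst.snd.snd
      (cons (sexpCons id.fst.snd.fst id.snd.fst) id.snd.snd))) (cons (const _) id.snd.snd)
  · intro a s b _
    cases b
    · simp only [decodeStep, cond_false, esize_cons]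
      have : esize Sexp.nil = 1 := rfl
      omega
    · match s with
      | [] => simp [decodeStep]
      | [x] => simp [decodeStep]
      | x :: y :: u =>
        have : esize (Sexp.cons x y) = esize x + esize y + 1 := rfl
        simp only [decodeStep, listElim_cons, cond_true, esize_cons, this]
        omega

theorem unpair {l : α → List Bool} (hl : PolyTime A l) : PolyTime A (fun a => unpair (l a)) := by
  have : PolyTime A fun a => (l a).foldl (fun s _ => unpairStep s) ([], l a) := by
    refine foldl_of_add (F := fun _ s _ => unpairStep s) (i := fun a => ([], l a)) ?_ hl
      (pair (const _) hl) (PolyBound.const 0) ?_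
    · exact listCases id.snd.fst.snd id.snd.fst (cond id.snd.fst (listCases id.snd.snd
        id.fst.snd.fst (pair (cons id.snd.fst id.fst.fst.snd.fst.fst) id.snd.snd))
        id.fst.snd.fst)
    · rintro a ⟨x, y⟩ b _
      match y with
      | [] => simp [unpairStep]
      | false :: t => simp [unpairStep]
      | [true] => simp [unpairStep]
      | true :: c :: u =>
        simp only [unpairStep, listElim_cons, cond_true, esize_pair, esize_cons]
        omega
  exact pair this.fst.reverse this.snd.tail

open Classical in
theorem oracle {β : Type} [HasRep β] {f : α → β} (hf : PolyTime A f) :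
    PolyTime A (fun a => decide ((rep (f a)).enc ∈ A)) :=
  FP.comp (FP.oracle (e := fun a => rep (f a))) hf

end PolyTime

theorem PolyTime.mem_PWith {A L : Language Bool} {f : List Bool → Bool} (hf : PolyTime A f)
    (h : ∀ x, x ∈ L ↔ f x = true) : L ∈ PWith A := FP.mem_PWith hf h

/-- The language of the codes of elements `q` of `α` such that `check q c` for some element `c`
of `β` is in `NP`, if `c` can be chosen of polynomial size. -/
theorem exists_mem_NP {α β : Type} [HasRep α] [HasRep β] [Readable α] [Readable β]
    {check : α → β → Bool} (hc : ∀ A, PolyTime A fun p : α × β => check p.1 p.2)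
    (B : Polynomial ℕ)
    (hB : ∀ q c, check q c = true → ∃ c', check q c' = true ∧ esize c' ≤ B.eval (esize q)) :
    ∃ A ∈ NP, ∀ q : α, (rep q).enc ∈ A ↔ ∃ c, check q c = true := by
  let verify : List Bool → Bool := fun z =>
    check (read (decode (unpair z).1)) (read (decode (unpair z).2))
  have hv : ∀ A, PolyTime A verify := fun A =>
    (hc A).comp ((((polyTime A).comp PolyTime.id.unpair.fst.decode)).pair
      ((polyTime A).comp PolyTime.id.unpair.snd.decode))
  let R : Language Bool := {z | verify z = true}
  refine ⟨{x | ∃ y : List Bool, y.length ≤ B.eval x.length ∧ pair x y ∈ R}, ?_, fun q => ?_⟩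
  · exact ⟨R, (hv 0).mem_PWith fun x => Iff.rfl, B, fun x => Iff.rfl⟩
  · change (∃ y : List Bool, y.length ≤ _ ∧ check _ _ = true) ↔ _
    simp only [unpair_pair, decode_enc, read_rep, length_enc]
    constructor
    -- Every string reads as some element of `β`, so `y` need not be a proper code.
    · rintro ⟨y, -, h⟩
      exact ⟨_, h⟩
    · rintro ⟨c, h⟩
      obtain ⟨c', h', hs⟩ := hB q c h
      refine ⟨(rep c').enc, ?_, ?_⟩
      · rw [length_enc]
        exact hs
      · rwa [decode_enc, read_rep]

end Complexity

/-! ### Certificates for allocations -/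

namespace FairDivision

open Complexity

/-- Adjacency in the graph on the natural numbers with edge list `E`. -/
def adjB (E : List (ℕ × ℕ)) (v w : ℕ) : Bool :=
  !decide (v = w) && E.any fun e =>
    (decide (e.1 = v) && decide (e.2 = w)) || (decide (e.1 = w) && decide (e.2 = v))

/-- Add a node to a list of nodes, checking that it is adjacent to one of them. -/
def grow (E : List (ℕ × ℕ)) (v : ℕ) (s : List ℕ × Bool) : List ℕ × Bool :=
  (v :: s.1, (s.1.isEmpty || s.1.any (adjB E v)) && s.2)

/-- Each node of the list except the last one is adjacent to a later one. -/
def connB (E : List (ℕ × ℕ)) (l : List ℕ) : Bool := (l.foldr (grow E) ([], true)).2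

/-- `l` is a permutation of the numbers below the length of `ms`. -/
def permB (ms : List Bool) (l : List ℕ) : Bool :=
  decide (l.length = ms.length) &&
    (List.range ms.length).all fun v => l.any fun x => decide (x = v)

/-- Add a fraction to the sum of the fractions of the elements of `S`, without cancellation. -/
def scaledStep (S : List ℕ) (t : ℕ × ℕ × ℕ) (s : ℕ × ℕ) : ℕ × ℕ :=
  (s.1 * t.2.2 + (bif S.any (fun x => decide (x = t.1)) then t.2.1 * s.2 else 0), s.2 * t.2.2)

/-- The sum of the fractions in `row` at the positions in `S`, multiplied by all denominators. -/
def scaledB (S : List ℕ) (row : List (ℕ × ℕ)) : ℕ :=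
  (((List.range row.length).zip row).foldr (scaledStep S) (0, 1)).1

/-- The row with index `i`, or `[]`. -/
def rowAt (rows : List (List (ℕ × ℕ))) (i : ℕ) : List (ℕ × ℕ) :=
  ((List.range rows.length).zip rows).foldr (fun p r => bif decide (p.1 = i) then p.2 else r) []

/-- The representation of the instance given by `ms` (whose length is the number of goods), the
edge list `E` and the table `rows` of utilities. -/
def encodeB (ms : List Bool) (E : List (ℕ × ℕ)) (rows : List (List (ℕ × ℕ))) : List Bool :=
  (ms.map (fun _ => true) ++ [false]) ++ ((rows.map (fun _ => true) ++ [false]) ++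
    (((List.range ms.length).flatMap fun v => (List.range ms.length).flatMap fun w =>
      [adjB E v w]) ++
      rows.flatMap fun r => r.flatMap fun p => encodeNat p.1 ++ encodeNat p.2))

/-- `ms`, `E` and `rows` describe an instance, whose connectedness is witnessed by `ord`. -/
def wfB (ms : List Bool) (E : List (ℕ × ℕ)) (rows : List (List (ℕ × ℕ))) (ord : List ℕ) : Bool :=
  !ms.isEmpty && (!rows.isEmpty && ((rows.all fun r => decide (r.length = ms.length) &&
    r.all fun p => !decide (p.2 = 0)) && (connB E ord && permB ms ord)))

/-- `P` describes a split into `n` bundles, where `n` is the number of rows. -/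
def splitB (ms : List Bool) (E : List (ℕ × ℕ)) (rows : List (List (ℕ × ℕ)))
    (P : List (List ℕ)) : Bool :=
  decide (P.length = rows.length) && (P.all (connB E) && permB ms P.flatten)

/-- The bundle of each agent `j` has at least the value `τ` for the agent `i`, where `(i, τ)` is
the `j`-th entry of the list `qs`. -/
def strongB (rows : List (List (ℕ × ℕ))) (P : List (List ℕ)) (qs : List (ℕ × ℕ)) : Bool :=
  (P.zip qs).all fun x => decide (x.2.2 ≤ scaledB x.1 (rowAt rows x.2.1))

/-- Certificates: the number of goods in unary, the edges, the table of utilities, a witness of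
connectedness, and a split. -/
abbrev Cert := List Bool × List (ℕ × ℕ) × List (List (ℕ × ℕ)) × List ℕ × List (List ℕ)

/-- Queries: a bit string and a list of agents with thresholds. -/
abbrev Query := List Bool × List (ℕ × ℕ)

/-- The verification of a certificate. -/
def check (q : Query) (c : Cert) : Bool :=
  decide (q.1 = encodeB c.1 c.2.1 c.2.2.1) && (wfB c.1 c.2.1 c.2.2.1 c.2.2.2.1 &&
    (splitB c.1 c.2.1 c.2.2.1 c.2.2.2.2 && strongB c.2.2.1 c.2.2.2.2 q.2))

end FairDivision

/-! ### The verifier runs in polynomial time -/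

namespace Complexity.PolyTime

open FairDivision

variable {A : Language Bool} {α : Type} [HasRep α]

theorem natMem {l : α → List ℕ} {v : α → ℕ} (hl : PolyTime A l) (hv : PolyTime A v) :
    PolyTime A fun a => (l a).any fun x => decide (x = v a) :=
  hl.any (p := fun a x => decide (x = v a)) (natEq id.snd (hv.comp id.fst))

theorem adjB {E : α → List (ℕ × ℕ)} {v w : α → ℕ} (hE : PolyTime A E) (hv : PolyTime A v)
    (hw : PolyTime A w) : PolyTime A fun a => adjB (E a) (v a) (w a) := by
  refine (hv.natEq hw).not.and (hE.any (p := fun a e => (decide (e.1 = v a) && decide (e.2 = w a))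
    || (decide (e.1 = w a) && decide (e.2 = v a))) ?_)
  have hv' : PolyTime A fun p : α × ℕ × ℕ => v p.1 := hv.comp id.fst
  have hw' : PolyTime A fun p : α × ℕ × ℕ => w p.1 := hw.comp id.fst
  exact ((id.snd.fst.natEq hv').and (id.snd.snd.natEq hw')).or
    ((id.snd.fst.natEq hw').and (id.snd.snd.natEq hv'))

theorem connB {E : α → List (ℕ × ℕ)} {l : α → List ℕ} (hE : PolyTime A E) (hl : PolyTime A l) :
    PolyTime A fun a => connB (E a) (l a) := by
  refine snd (foldr_of_add (F := fun a v s => grow (E a) v s) (i := fun _ => ([], true)) ?_ hl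
    (const _) (hl.bound.add (PolyBound.const 5)) fun a s v hv => ?_)
  · refine pair (cons id.snd.fst id.snd.snd.fst) (((isEmpty id.snd.snd.fst).or
      (any (p := fun p x => FairDivision.adjB (E p.1) p.2.1 x) id.snd.snd.fst ?_)).and
      id.snd.snd.snd)
    exact adjB (hE.comp id.fst.fst) id.fst.snd.fst id.snd
  · have h1 := esize_le_of_mem hv
    have h2 := esize_bool (grow (E a) v s).2
    have h3 := one_le_esize s.2
    have h4 : (grow (E a) v s).1 = v :: s.1 := rfl
    simp only [esize_pair, h4, esize_cons]
    omega

theorem permB {ms : α → List Bool} {l : α → List ℕ} (hm : PolyTime A ms) (hl : PolyTime A l) :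
    PolyTime A fun a => permB (ms a) (l a) := by
  refine (hl.length.natEq hm.length).and (hm.range.all
    (p := fun a v => (l a).any fun x => decide (x = v)) ?_)
  exact natMem (hl.comp id.fst) id.snd

/-- Although fractions are never reduced, one summand multiplies by numbers with at most `esize (r
a)` digits, and the addition costs one digit more. The digits of numerator and denominator thus grow
additively. -/
theorem scaledB {S : α → List ℕ} {r : α → List (ℕ × ℕ)} (hS : PolyTime A S) (hr : PolyTime A r) :
    PolyTime A fun a => scaledB (S a) (r a) := by
  refine fst (foldr_of_measure (F := fun a t s => scaledStep (S a) t s) (i := fun _ => (0, 1)) ?_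
    (hr.range.zip hr) (const _) (fun _ s => max s.1.size s.2.size) (8 * Polynomial.X + 3) ?_
    (hr.bound.add (PolyBound.const 1)) ?_ ?_)
  · exact pair ((id.snd.snd.fst.mul id.snd.fst.snd.snd).add (cond (natMem (hS.comp id.fst)
      id.snd.fst.fst) (id.snd.fst.snd.fst.mul id.snd.snd.snd) (const 0)))
      (id.snd.snd.snd.mul id.snd.fst.snd.snd)
  · rintro a ⟨x, y⟩
    have := esize_nat_le x
    have := esize_nat_le y
    simp
    omega
  · intro a
    simp [Nat.size_one]
  · rintro a ⟨x, y⟩ ⟨v, n, d⟩ ht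
    have h0 := esize_le_of_mem (List.of_mem_zip ht).2
    have hn := size_le_esize n
    have hd := size_le_esize d
    simp only [esize_pair] at h0
    set k := max x.size y.size with hk
    have hx : x < 2 ^ k :=
      (Nat.lt_size_self _).trans_le (Nat.pow_le_pow_right (by norm_num) (le_max_left _ _))
    have hy : y < 2 ^ k :=
      (Nat.lt_size_self _).trans_le (Nat.pow_le_pow_right (by norm_num) (le_max_right _ _))
    have hn' : n < 2 ^ esize (r a) :=
      (Nat.lt_size_self _).trans_le (Nat.pow_le_pow_right (by norm_num) (by omega))
    have hd' : d < 2 ^ esize (r a) :=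
      (Nat.lt_size_self _).trans_le (Nat.pow_le_pow_right (by norm_num) (by omega))
    have h1 : x * d < 2 ^ (k + esize (r a)) := by
      rw [pow_add]; exact Nat.mul_lt_mul'' hx hd'
    have h2 : n * y < 2 ^ (k + esize (r a)) := by
      rw [pow_add, mul_comm]; exact Nat.mul_lt_mul'' hy hn'
    have h3 : y * d < 2 ^ (k + esize (r a)) := by
      rw [pow_add]; exact Nat.mul_lt_mul'' hy hd'
    rw [max_le_iff, Nat.size_le, Nat.size_le, ← add_assoc, pow_succ]
    refine ⟨?_, ?_⟩
    · simp only [scaledStep]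
      cases (S a).any fun x => decide (x = v) <;> simp only [cond_true, cond_false] <;> omega
    · simp only [scaledStep]
      omega

theorem rowAt {rows : α → List (List (ℕ × ℕ))} {i : α → ℕ} (hr : PolyTime A rows)
    (hi : PolyTime A i) : PolyTime A fun a => rowAt (rows a) (i a) := by
  refine foldr_of_add (F := fun a p r => bif decide (p.1 = i a) then p.2 else r) (i := fun _ => [])
    (cond (natEq id.snd.fst.fst (hi.comp id.fst)) id.snd.fst.snd id.snd.snd) (hr.range.zip hr)
    (const _) hr.bound fun a s p hp => ?_
  have := esize_le_of_mem (List.of_mem_zip hp).2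
  cases decide (p.1 = i a) <;> simp only [cond_true, cond_false] <;> omega

theorem encodeNat {f : α → ℕ} (hf : PolyTime A f) : PolyTime A fun a => encodeNat (f a) := by
  have h : PolyTime A fun a => (f a).bits.flatMap (fun b => [true, b]) ++ [false] :=
    (hf.natBits.flatMap (f := fun _ b => [true, b])
      (cons (const true) (cons id.snd (const [])))).append
      (const [false])
  exact h

theorem encodeB {ms : α → List Bool} {E : α → List (ℕ × ℕ)} {rows : α → List (List (ℕ × ℕ))}
    (hm : PolyTime A ms) (hE : PolyTime A E) (hr : PolyTime A rows) :
    PolyTime A fun a => encodeB (ms a) (E a) (rows a) := by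
  refine ((hm.map (f := fun _ _ => true) (const _)).append (const _)).append
    (((hr.map (f := fun _ _ => true) (const _)).append (const _)).append (append ?_ ?_))
  · refine hm.range.flatMap (f := fun a v => (List.range (ms a).length).flatMap fun w =>
      [FairDivision.adjB (E a) v w]) ?_
    refine (range (hm.comp id.fst)).flatMap (f := fun p w => [FairDivision.adjB (E p.1) p.2 w]) ?_
    exact cons (adjB (hE.comp id.fst.fst) id.fst.snd id.snd) (const _)
  · have h1 : PolyTime A fun p : (α × List (ℕ × ℕ)) × ℕ × ℕ =>
        FairDivision.encodeNat p.2.1 ++ FairDivision.encodeNat p.2.2 :=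
      append (encodeNat id.snd.fst) (encodeNat id.snd.snd)
    have h2 : PolyTime A fun p : α × List (ℕ × ℕ) => p.2.flatMap fun q =>
        FairDivision.encodeNat q.1 ++ FairDivision.encodeNat q.2 := flatMap id.snd h1
    exact flatMap hr h2

theorem wfB {ms : α → List Bool} {E : α → List (ℕ × ℕ)} {rows : α → List (List (ℕ × ℕ))}
    {ord : α → List ℕ} (hm : PolyTime A ms) (hE : PolyTime A E) (hr : PolyTime A rows)
    (ho : PolyTime A ord) : PolyTime A fun a => wfB (ms a) (E a) (rows a) (ord a) := by
  have h : PolyTime A fun a => (rows a).all fun r => decide (r.length = (ms a).length) &&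
      r.all fun p => !decide (p.2 = 0) := by
    refine hr.all (p := fun a r => decide (r.length = (ms a).length) &&
      r.all fun p => !decide (p.2 = 0)) (and ?_ ?_)
    · exact natEq id.snd.length (length (hm.comp id.fst))
    · have h1 : PolyTime A fun p : (α × List (ℕ × ℕ)) × ℕ × ℕ => !decide (p.2.2 = 0) :=
        (natEq id.snd.snd (const 0)).not
      exact all id.snd h1
  exact hm.isEmpty.not.and (hr.isEmpty.not.and (h.and ((connB hE ho).and (permB hm ho))))

theorem splitB {ms : α → List Bool} {E : α → List (ℕ × ℕ)} {rows : α → List (List (ℕ × ℕ))}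
    {P : α → List (List ℕ)} (hm : PolyTime A ms) (hE : PolyTime A E) (hr : PolyTime A rows)
    (hP : PolyTime A P) : PolyTime A fun a => splitB (ms a) (E a) (rows a) (P a) :=
  (natEq hP.length hr.length).and ((hP.all (p := fun a l => FairDivision.connB (E a) l)
    (connB (hE.comp id.fst) id.snd)).and (permB hm hP.flatten))

theorem strongB {rows : α → List (List (ℕ × ℕ))} {P : α → List (List ℕ)} {qs : α → List (ℕ × ℕ)}
    (hr : PolyTime A rows) (hP : PolyTime A P) (hq : PolyTime A qs) :
    PolyTime A fun a => strongB (rows a) (P a) (qs a) := by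
  have h : PolyTime A fun p : α × List ℕ × ℕ × ℕ =>
      decide (p.2.2.2 ≤ FairDivision.scaledB p.2.1 (FairDivision.rowAt (rows p.1) p.2.2.1)) :=
    le id.snd.snd.snd (scaledB id.snd.fst (rowAt (hr.comp id.fst) id.snd.snd.fst))
  exact all (hP.zip hq) h

theorem check : PolyTime A fun p : Query × Cert => check p.1 p.2 := by
  have hm : PolyTime A fun p : Query × Cert => p.2.1 := id.snd.fst
  have hE : PolyTime A fun p : Query × Cert => p.2.2.1 := id.snd.snd.fst
  have hr : PolyTime A fun p : Query × Cert => p.2.2.2.1 := id.snd.snd.snd.fst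
  have ho : PolyTime A fun p : Query × Cert => p.2.2.2.2.1 := id.snd.snd.snd.snd.fst
  have hP : PolyTime A fun p : Query × Cert => p.2.2.2.2.2 := id.snd.snd.snd.snd.snd
  exact (id.fst.fst.bitsEq (encodeB hm hE hr)).and ((wfB hm hE hr ho).and
    ((splitB hm hE hr hP).and (strongB hr hP id.fst.snd)))

end Complexity.PolyTime

/-! ### Soundness and completeness of the certificates -/

namespace FairDivision

open Complexity

theorem foldr_grow_fst (E : List (ℕ × ℕ)) (l : List ℕ) : (l.foldr (grow E) ([], true)).1 = l := by
  induction l with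
  | nil => rfl
  | cons v l ih => exact congrArg (v :: ·) ih

theorem connB_cons (E : List (ℕ × ℕ)) (v : ℕ) (l : List ℕ) :
    connB E (v :: l) = ((l.isEmpty || l.any (adjB E v)) && connB E l) := by
  simp only [connB, List.foldr_cons, grow, foldr_grow_fst]

/-- The nodes in a list of numbers. -/
def nodes (m : ℕ) (l : List ℕ) : Finset (Fin m) := Finset.univ.filter fun v => (v : ℕ) ∈ l

@[simp] theorem mem_nodes {m : ℕ} {l : List ℕ} {v : Fin m} : v ∈ nodes m l ↔ (v : ℕ) ∈ l := by
  simp [nodes]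

section Graph
variable {m : ℕ} {G : SimpleGraph (Fin m)} {E : List (ℕ × ℕ)}

/-- The list is read from its end: an edge joins each new node to the connected set of the nodes
already read. -/
theorem isBundle_nodes (hE : ∀ v w : Fin m, adjB E v w = true ↔ G.Adj v w) (l : List ℕ)
    (hl : ∀ x ∈ l, x < m) (hc : connB E l = true) : IsBundle G (nodes m l) := by
  induction l with
  | nil => rintro ⟨v, hv⟩; simp at hv
  | cons v l ih =>
    rw [connB_cons, Bool.and_eq_true, Bool.or_eq_true] at hc
    have hi := ih (fun x hx => hl x (by simp [hx])) hc.2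
    let v' : Fin m := ⟨v, hl v (by simp)⟩
    have hs : (nodes m (v :: l) : Set (Fin m)) = {v'} ∪ (nodes m l : Set (Fin m)) := by
      ext x
      simp [v', Fin.ext_iff]
    have h1 : (G.induce {v'}).Preconnected := by
      rintro ⟨x, rfl⟩ ⟨y, rfl⟩
      rfl
    rw [IsBundle, hs]
    rcases hc.1 with h | h
    · have : l = [] := by simpa using h
      subst this
      have : ((nodes m [] : Finset (Fin m)) : Set (Fin m)) = ∅ := by ext; simp
      rw [this, Set.union_empty]
      exact h1
    · obtain ⟨w, hw, ha⟩ := List.any_eq_true.1 h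
      let w' : Fin m := ⟨w, hl w (by simp [hw])⟩
      exact (SimpleGraph.connected_induce_union (v := v') (w := w') h1 hi rfl
        (by simpa [w'] using hw) ((hE v' w').1 ha)).preconnected

/-- The list is grown one node at a time. While nodes of `P` are missing, a walk inside `P` from a
listed node to a missing one must leave the listed set along some edge, whose far end is put in
front. -/
theorem exists_connB (hE : ∀ v w : Fin m, adjB E v w = true ↔ G.Adj v w) (P : Finset (Fin m))
    (hP : IsBundle G P) :
    ∃ l : List (Fin m), l.Nodup ∧ l.toFinset = P ∧ connB E (l.map Fin.val) = true := by
  have key : ∀ k ≤ P.card, ∃ l : List (Fin m), l.Nodup ∧ l.toFinset ⊆ P ∧ l.length = k ∧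
      connB E (l.map Fin.val) = true := by
    intro k
    induction k with
    | zero => exact fun _ => ⟨[], by simp, by simp, rfl, rfl⟩
    | succ k ih =>
      intro hk
      obtain ⟨l, h1, h2, h3, h4⟩ := ih (by omega)
      have hlt : l.toFinset.card < P.card := by rw [List.toFinset_card_of_nodup h1]; omega
      obtain ⟨v, hv, hvl⟩ := Finset.exists_mem_notMem_of_card_lt_card hlt
      cases l with
      | nil =>
        exact ⟨[v], by simp, by simpa using hv, by simpa using h3.symm, rfl⟩
      | cons u t =>
        have hu : u ∈ P := h2 (by simp)
        obtain ⟨p⟩ := hP ⟨u, hu⟩ ⟨v, hv⟩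
        obtain ⟨d, -, hd1, hd2⟩ := p.exists_boundary_dart {x | x.1 ∈ u :: t} (by simp)
          (by simpa using hvl)
        refine ⟨d.snd.1 :: u :: t, List.nodup_cons.2 ⟨hd2, h1⟩, ?_, by simpa using h3, ?_⟩
        · rw [List.toFinset_cons]
          exact Finset.insert_subset d.snd.2 h2
        · rw [List.map_cons, connB_cons, h4, Bool.and_true, Bool.or_eq_true]
          refine Or.inr (List.any_eq_true.2 ⟨d.fst.1, List.mem_map_of_mem hd1, ?_⟩)
          exact (hE _ _).2 d.adj.symm
  obtain ⟨l, h1, h2, h3, h4⟩ := key P.card le_rfl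
  exact ⟨l, h1, Finset.eq_of_subset_of_card_le h2
    (by rw [List.toFinset_card_of_nodup h1, h3]), h4⟩

theorem isBundle_univ_iff : IsBundle G Finset.univ ↔ G.Preconnected := by
  rw [IsBundle, Finset.coe_univ]
  exact G.induceUnivIso.preconnected_iff

end Graph

/-- A list that contains all elements of a duplicate-free list and has the same length is a
permutation of it. -/
theorem permB_iff {ms : List Bool} {l : List ℕ} :
    permB ms l = true ↔ l.Perm (List.range ms.length) := by
  constructor
  · intro h
    simp only [permB, Bool.and_eq_true, decide_eq_true_eq, List.all_eq_true, List.any_eq_true,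
      exists_eq_right] at h
    exact ((List.subperm_of_subset List.nodup_range fun v hv => h.2 v hv).perm_of_length_le
      (by simp [h.1])).symm
  · intro h
    simp only [permB, Bool.and_eq_true, decide_eq_true_eq, List.all_eq_true, List.any_eq_true,
      exists_eq_right]
    exact ⟨by simpa using h.length_eq, fun v hv => h.mem_iff.2 hv⟩

theorem range_eq_finRange (n : ℕ) : List.range n = (List.finRange n).map Fin.val :=
  (List.map_coe_finRange_eq_range ..).symm

theorem range_zip_finRange {α : Type} {n : ℕ} (f : Fin n → α) :
    (List.range n).zip ((List.finRange n).map f) =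
      (List.finRange n).map fun i : Fin n => ((i : ℕ), f i) := by
  rw [range_eq_finRange, List.zip_map']

theorem rowAt_map {n : ℕ} (f : Fin n → List (ℕ × ℕ)) (i : Fin n) :
    rowAt ((List.finRange n).map f) i = f i := by
  have key : ∀ l : List (Fin n), i ∈ l → (l.map fun j : Fin n => ((j : ℕ), f j)).foldr
      (fun p r => bif decide (p.1 = (i : ℕ)) then p.2 else r) [] = f i := by
    intro l
    induction l with
    | nil => simp
    | cons j l ih =>
      intro h
      by_cases hj : j = i
      · simp [hj]
      · have hi := ih (by simpa [Ne.symm hj] using h)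
        have hne : ¬(j : ℕ) = i := fun e => hj (Fin.ext e)
        simpa [hne] using hi
  have := key (List.finRange n) (List.mem_finRange i)
  rw [rowAt, List.length_map, List.length_finRange, range_zip_finRange, this]

theorem scaledB_map {m : ℕ} (S : List ℕ) (num den : Fin m → ℕ) (hd : ∀ v, 0 < den v) :
    (scaledB S ((List.finRange m).map fun v => (num v, den v)) : ℝ) =
      (∏ v, (den v : ℝ)) * value (fun v => (num v : ℝ) / den v) (nodes m S) := by
  -- The invariant: the second component is the product of the denominators met, and the first is
  -- that product times the partial sum.
  have key : ∀ l : List (Fin m),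
      let r := (l.map fun v : Fin m => ((v : ℕ), num v, den v)).foldr (scaledStep S) (0, 1)
      (r.2 : ℝ) = (l.map fun v => (den v : ℝ)).prod ∧
      (r.1 : ℝ) = r.2 *
        (l.map fun v : Fin m => if (v : ℕ) ∈ S then (num v : ℝ) / den v else 0).sum := by
    intro l
    induction l with
    | nil => simp
    | cons v l ih =>
      obtain ⟨h1, h2⟩ := ih
      have hd' : (den v : ℝ) ≠ 0 := by exact_mod_cast (hd v).ne'
      have hS : S.any (fun x => decide (x = (v : ℕ))) = decide ((v : ℕ) ∈ S) := by
        rw [Bool.eq_iff_iff]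
        simp
      simp only [List.map_cons, List.foldr_cons, List.prod_cons, List.sum_cons]
      generalize (l.map fun v : Fin m => ((v : ℕ), num v, den v)).foldr (scaledStep S) (0, 1) = r
        at h1 h2
      refine ⟨?_, ?_⟩
      · simp only [scaledStep]
        push_cast
        rw [h1, mul_comm]
      · simp only [scaledStep, hS]
        by_cases h : (v : ℕ) ∈ S
        · simp only [h, decide_true, cond_true, if_true]
          push_cast
          rw [h2]
          field_simp
          ring
        · simp only [h, decide_false, cond_false, if_false]
          push_cast
          rw [h2]
          ring
  obtain ⟨h1, h2⟩ := key (List.finRange m)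
  rw [scaledB, List.length_map, List.length_finRange, range_zip_finRange, h2, h1]
  have e1 : ((List.finRange m).map fun v => (den v : ℝ)).prod = ∏ v, (den v : ℝ) := by
    rw [← List.ofFn_eq_map, List.prod_ofFn]
  have e2 : ((List.finRange m).map fun v : Fin m =>
      if (v : ℕ) ∈ S then (num v : ℝ) / den v else 0).sum =
      ∑ v : Fin m, if (v : ℕ) ∈ S then (num v : ℝ) / den v else 0 := by
    rw [← List.ofFn_eq_map, List.sum_ofFn]
  rw [e1, e2, value, nodes, Finset.sum_filter]

namespace Instance
variable (I : Instance)

/-- The table of utilities. -/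
def table : List (List (ℕ × ℕ)) :=
  (List.finRange I.n).map fun i => (List.finRange I.m).map fun v => (I.num i v, I.den i v)

/-- The common denominator of the utilities of an agent. -/
def scale (i : Fin I.n) : ℝ := ∏ v, (I.den i v : ℝ)

/-- `ms`, `E` and `rows` describe the instance. -/
structure Matches (ms : List Bool) (E : List (ℕ × ℕ)) (rows : List (List (ℕ × ℕ))) : Prop where
  length : ms.length = I.m
  rows : rows = I.table
  adj : ∀ v w : Fin I.m, adjB E v w = true ↔ I.G.Adj v w

variable {I} {ms : List Bool} {E : List (ℕ × ℕ)} {rows : List (List (ℕ × ℕ))}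

theorem Matches.encodeB_eq (h : I.Matches ms E rows) : encodeB ms E rows = I.encode := by
  classical
  obtain ⟨h1, rfl, h3⟩ := h
  have e1 : (ms.map fun _ => true) = List.replicate I.m true := by rw [List.map_const', h1]
  have e2 : (I.table.map fun _ => true) = List.replicate I.n true := by
    rw [List.map_const', table, List.length_map, List.length_finRange]
  rw [encodeB, e1, e2, h1, encode, range_eq_finRange, table]
  simp only [List.flatMap_map, encodeUnary]
  congr 3
  refine List.flatMap_congr fun v _ => List.flatMap_congr fun w _ => ?_
  rw [List.cons.injEq, Bool.eq_iff_iff, h3, decide_eq_true_eq]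
  exact ⟨Iff.rfl, rfl⟩

theorem scaledB_rowAt (S : List ℕ) (i : Fin I.n) :
    (scaledB S (rowAt I.table i) : ℝ) = I.scale i * value (I.utility i) (nodes I.m S) := by
  rw [table, rowAt_map, scaledB_map _ _ _ (I.den_pos i)]
  rfl

/-- The tests in `wfB` are those needed to build an instance from arbitrary lists. Symmetry and
looplessness hold for every edge list, because `adjB` reads edges in both directions and excludes
equal ends; connectedness comes from `ord`, which lists all nodes. -/
theorem exists_matches {ord : List ℕ} (h : wfB ms E rows ord = true) :
    ∃ I : Instance, I.Matches ms E rows := by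
  simp only [wfB, Bool.and_eq_true, Bool.not_eq_true', List.isEmpty_eq_false_iff,
    List.all_eq_true, decide_eq_true_eq, decide_eq_false_iff_not, permB_iff] at h
  obtain ⟨h1, h2, h3, h4, h5⟩ := h
  let G : SimpleGraph (Fin ms.length) :=
    { Adj := fun v w => adjB E v w = true
      symm := ⟨fun v w h => by
        simp only [adjB, Bool.and_eq_true, Bool.not_eq_true', decide_eq_false_iff_not,
          List.any_eq_true, Bool.or_eq_true, decide_eq_true_eq] at h ⊢
        obtain ⟨h, e, he, h'⟩ := h
        exact ⟨Ne.symm h, e, he, h'.symm⟩⟩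
      loopless := ⟨fun v h => by simp [adjB] at h⟩ }
  have hG : G.Connected := by
    have : Nonempty (Fin ms.length) := ⟨⟨0, List.length_pos_of_ne_nil h1⟩⟩
    refine ⟨isBundle_univ_iff.1 ?_⟩
    have hb := isBundle_nodes (G := G) (fun v w => Iff.rfl) ord
      (fun x hx => List.mem_range.1 (h5.mem_iff.1 hx)) h4
    have : nodes ms.length ord = Finset.univ := by
      ext v
      simp [h5.mem_iff]
    rwa [this] at hb
  have hr : ∀ i (hi : i < rows.length), (rows[i]).length = ms.length := fun i hi =>
    (h3 _ (List.getElem_mem hi)).1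
  refine ⟨⟨ms.length, rows.length, G,
    fun i v => ((rows[i])[(v : ℕ)]'(by rw [Fin.getElem_fin, hr]; exact v.2)).1,
    fun i v => ((rows[i])[(v : ℕ)]'(by rw [Fin.getElem_fin, hr]; exact v.2)).2,
    List.length_pos_of_ne_nil h2, hG, fun i v => Nat.pos_of_ne_zero
      ((h3 _ (List.getElem_mem i.2)).2 _ (List.getElem_mem _))⟩, rfl, ?_, fun v w => Iff.rfl⟩
  refine List.ext_getElem (by simp [table]) fun i hi _ => ?_
  refine List.ext_getElem (by simp [table, hr]) fun v hv _ => ?_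
  simp [table]

/-- A certificate yields a split. -/
theorem Matches.isSplit (h : I.Matches ms E rows) {P : List (List ℕ)}
    (hP : splitB ms E rows P = true) :
    IsSplit I.G fun j : Fin I.n => nodes I.m (P.getD j []) := by
  simp only [splitB, Bool.and_eq_true, decide_eq_true_eq, List.all_eq_true, permB_iff] at hP
  obtain ⟨h1, h2, h3⟩ := hP
  rw [h.length] at h3
  -- Hence the default `[]` of `getD` is never used.
  have hn : P.length = I.n := by rw [h1, h.rows, table, List.length_map, List.length_finRange]
  have hg : ∀ j : Fin I.n, P.getD j [] = P[(j : ℕ)]'(by rw [hn]; exact j.2) := fun j =>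
    List.getD_eq_getElem ..
  have hnd := List.nodup_flatten.1 (h3.nodup_iff.2 List.nodup_range)
  refine ⟨fun j => ?_, fun i j hij => ?_, fun v => ?_⟩
  · rw [hg]
    refine isBundle_nodes h.adj _ (fun x hx => ?_) (h2 _ (List.getElem_mem _))
    exact List.mem_range.1 (h3.mem_iff.1 (List.mem_flatten.2 ⟨_, List.getElem_mem _, hx⟩))
  · rw [Finset.disjoint_left]
    intro v hi hj
    rw [mem_nodes, hg] at hi hj
    have hp := List.pairwise_iff_getElem.1 hnd.2
    rcases lt_or_gt_of_ne (fun e => hij (Fin.ext e) : (i : ℕ) ≠ j) with hlt | hlt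
    · exact hp i j _ _ hlt hi hj
    · exact hp j i _ _ hlt hj hi
  · obtain ⟨l, hl, hv⟩ := List.mem_flatten.1 (h3.mem_iff.2 (List.mem_range.2 v.2))
    obtain ⟨j, hj, rfl⟩ := List.getElem_of_mem hl
    refine ⟨⟨j, hn ▸ hj⟩, ?_⟩
    rw [mem_nodes, hg]
    exact hv

/-- Every instance is described by some certificate. -/
theorem exists_cert (I : Instance) : ∃ (ms : List Bool) (E : List (ℕ × ℕ)) (ord : List ℕ),
    I.Matches ms E I.table ∧ wfB ms E I.table ord = true := by
  classical
  let E : List (ℕ × ℕ) := (Finset.univ.filter fun p : Fin I.m × Fin I.m =>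
    I.G.Adj p.1 p.2).toList.map fun p => ((p.1 : ℕ), (p.2 : ℕ))
  have hE : ∀ v w : Fin I.m, adjB E v w = true ↔ I.G.Adj v w := by
    intro v w
    simp only [adjB, Bool.and_eq_true, Bool.not_eq_true', decide_eq_false_iff_not,
      List.any_eq_true, Bool.or_eq_true, decide_eq_true_eq, E, List.mem_map, Finset.mem_toList,
      Finset.mem_filter, Finset.mem_univ, true_and]
    constructor
    · rintro ⟨-, _, ⟨⟨x, y⟩, hxy, rfl⟩, ⟨h1, h2⟩ | ⟨h1, h2⟩⟩
      · rwa [← Fin.ext h1, ← Fin.ext h2]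
      · rw [← Fin.ext h1, ← Fin.ext h2]
        exact hxy.symm
    · intro h
      exact ⟨fun e => h.ne (Fin.ext e), _, ⟨(v, w), h, rfl⟩, Or.inl ⟨rfl, rfl⟩⟩
  obtain ⟨l, h1, h2, h3⟩ := exists_connB hE Finset.univ
    (isBundle_univ_iff.2 I.connected.preconnected)
  refine ⟨List.replicate I.m true, E, l.map Fin.val, ⟨by simp, rfl, hE⟩, ?_⟩
  simp only [wfB, Bool.and_eq_true, Bool.not_eq_true', List.isEmpty_eq_false_iff,
    List.all_eq_true, decide_eq_true_eq, decide_eq_false_iff_not, permB_iff]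
  refine ⟨?_, ?_, ?_, h3, ?_⟩
  · obtain ⟨v⟩ := I.connected.nonempty
    have := v.pos
    simp
    omega
  · have := I.n_pos
    simp [table]
    omega
  · intro r hr
    obtain ⟨i, -, rfl⟩ := List.mem_map.1 hr
    refine ⟨by simp, fun p hp => ?_⟩
    obtain ⟨v, -, rfl⟩ := List.mem_map.1 hp
    exact (I.den_pos i v).ne'
  · rw [List.length_replicate, range_eq_finRange]
    refine List.Perm.map _ ?_
    rw [List.perm_ext_iff_of_nodup h1 (List.nodup_finRange _)]
    intro v
    rw [← List.mem_toFinset, h2]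
    simp

/-- A split yields a certificate. -/
theorem Matches.exists_splitB (h : I.Matches ms E rows) {P : Fin I.n → Finset (Fin I.m)}
    (hP : IsSplit I.G P) : ∃ L : Fin I.n → List ℕ, (∀ j, nodes I.m (L j) = P j) ∧
      splitB ms E rows ((List.finRange I.n).map L) = true := by
  choose l h1 h2 h3 using fun j => exists_connB h.adj (P j) (hP.bundle j)
  refine ⟨fun j => (l j).map Fin.val, fun j => ?_, ?_⟩
  · ext v
    rw [mem_nodes, ← h2, List.mem_toFinset, List.mem_map_of_injective Fin.val_injective]
  · simp only [splitB, Bool.and_eq_true, decide_eq_true_eq, List.all_eq_true, permB_iff, h.length]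
    refine ⟨by simp [h.rows, table], fun r hr => ?_, ?_⟩
    · obtain ⟨j, -, rfl⟩ := List.mem_map.1 hr
      exact h3 j
    · have e : ((List.finRange I.n).map fun j => (l j).map Fin.val).flatten =
          ((List.finRange I.n).flatMap l).map Fin.val := by
        rw [List.map_flatMap, List.flatMap]
      rw [e, range_eq_finRange]
      refine List.Perm.map _ ?_
      rw [List.perm_ext_iff_of_nodup _ (List.nodup_finRange _)]
      · intro v
        obtain ⟨j, hj⟩ := hP.cover v
        simp only [List.mem_flatMap, List.mem_finRange, true_and, iff_true]
        exact ⟨j, by rwa [← List.mem_toFinset, h2]⟩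
      · refine List.nodup_flatMap.2 ⟨fun j _ => h1 j, (List.nodup_finRange _).imp ?_⟩
        intro i j hij v hi hj
        rw [← List.mem_toFinset, h2] at hi hj
        exact Finset.disjoint_left.1 (hP.disjoint i j hij) hi hj

end Instance

/-- Since `zip` truncates, entries of `qs` beyond the number of bundles are ignored. Queries may
therefore be longer than the number of agents, which the oracle algorithm does not compute. -/
theorem strongB_iff {rows : List (List (ℕ × ℕ))} {P : List (List ℕ)} {qs : List (ℕ × ℕ)} :
    strongB rows P qs = true ↔ ∀ (j i τ : ℕ) (S : List ℕ), P[j]? = some S →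
      qs[j]? = some (i, τ) → τ ≤ scaledB S (rowAt rows i) := by
  simp only [strongB, List.all_eq_true, decide_eq_true_eq]
  constructor
  · intro h j i τ S h1 h2
    refine h (S, i, τ) (List.mem_of_getElem? (i := j) ?_)
    rw [List.getElem?_zip_eq_some]
    exact ⟨h1, h2⟩
  · rintro h ⟨S, i, τ⟩ hx
    obtain ⟨j, hj⟩ := List.mem_iff_getElem?.1 hx
    rw [List.getElem?_zip_eq_some] at hj
    exact h j i τ S hj.1 hj.2

/-- What the certificates certify. -/
theorem exists_check_iff (I : Instance) (qs : List (ℕ × ℕ)) (a : Fin I.n → Fin I.n)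
    (τ : Fin I.n → ℕ) (hq : ∀ j : Fin I.n, qs[(j : ℕ)]? = some ((a j : ℕ), τ j)) :
    (∃ c, check (I.encode, qs) c = true) ↔ ∃ P : Fin I.n → Finset (Fin I.m), IsSplit I.G P ∧
      ∀ j, (τ j : ℝ) ≤ I.scale (a j) * value (I.utility (a j)) (P j) := by
  constructor
  · rintro ⟨⟨ms, E, rows, ord, P⟩, h⟩
    simp only [check, Bool.and_eq_true, decide_eq_true_eq, strongB_iff] at h
    obtain ⟨h1, h2, h3, h4⟩ := h
    obtain ⟨J, hJ⟩ := Instance.exists_matches h2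
    -- The certificate brings its own instance `J`, but equal encodings force it to be `I`.
    obtain rfl : I = J := Instance.encode_injective (h1.trans hJ.encodeB_eq)
    refine ⟨_, hJ.isSplit h3, fun j => ?_⟩
    rw [← Instance.scaledB_rowAt, ← hJ.rows]
    have hn : P.length = I.n := by
      simp only [splitB, Bool.and_eq_true, decide_eq_true_eq] at h3
      rw [h3.1, hJ.rows, Instance.table, List.length_map, List.length_finRange]
    refine Nat.cast_le.2 (h4 j (a j) (τ j) _ ?_ (hq j))
    rw [List.getD_eq_getElem _ _ (by rw [hn]; exact j.2), List.getElem?_eq_getElem]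
  · rintro ⟨P, hP, hτ⟩
    obtain ⟨ms, E, ord, hm, hw⟩ := I.exists_cert
    obtain ⟨L, hL, hs⟩ := hm.exists_splitB hP
    refine ⟨(ms, E, I.table, ord, (List.finRange I.n).map L), ?_⟩
    simp only [check, Bool.and_eq_true, decide_eq_true_eq, strongB_iff]
    refine ⟨hm.encodeB_eq.symm, hw, hs, fun j i t S h1 h2 => ?_⟩
    obtain ⟨hj, h1⟩ := List.getElem?_eq_some_iff.1 h1
    have hj' : j < I.n := by simpa using hj
    have e := (hq ⟨j, hj'⟩).symm.trans h2
    simp only [Option.some.injEq, Prod.mk.injEq] at e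
    have := hτ ⟨j, hj'⟩
    rw [← hL, ← Instance.scaledB_rowAt, Nat.cast_le] at this
    rw [← e.1, ← e.2, ← h1]
    simpa using this

end FairDivision

/-! ### The size of certificates -/

namespace FairDivision

open Complexity

theorem esize_list_le_of_length {α : Type} [HasRep α] {l : List α} {K B : ℕ} (hl : l.length ≤ K)
    (h : ∀ a ∈ l, esize a ≤ B) : esize l ≤ K * (B + 1) + 1 :=
  (esize_list_le l B h).trans (Nat.add_le_add_right (Nat.mul_le_mul_right _ hl) 1)

theorem length_le_length_flatMap {α β : Type} {l : List α} {f : α → List β} {a : α} (h : a ∈ l) :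
    (f a).length ≤ (l.flatMap f).length := by
  rw [List.length_flatMap]
  exact List.single_le_sum (by simp) _ (List.mem_map_of_mem h)

theorem size_le_length_encodeNat (k : ℕ) : k.size ≤ (encodeNat k).length := by
  rw [← Nat.size_eq_bits_len, encodeNat, delimit, List.length_append, List.length_flatMap]
  simp
  omega

theorem connB_congr {E E' : List (ℕ × ℕ)} {m : ℕ}
    (h : ∀ v w, v < m → w < m → adjB E' v w = adjB E v w) (l : List ℕ) (hl : ∀ x ∈ l, x < m) :
    connB E' l = connB E l := by
  induction l with
  | nil => rfl
  | cons v l ih =>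
    have : l.any (adjB E' v) = l.any (adjB E v) := by
      rw [Bool.eq_iff_iff, List.any_eq_true, List.any_eq_true]
      refine exists_congr fun w => and_congr_right fun hw => ?_
      rw [h v w (hl v (by simp)) (hl w (by simp [hw]))]
    rw [connB_cons, connB_cons, this, ih fun x hx => hl x (by simp [hx])]

/-- An edge list may contain repetitions and irrelevant numbers, so its length is not bounded by the
input. Only the adjacencies among the first `m` numbers matter, and at most m² pairs represent them.
-/
theorem exists_edges (E : List (ℕ × ℕ)) (m : ℕ) : ∃ E' : List (ℕ × ℕ), E'.length ≤ m * m ∧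
    (∀ e ∈ E', e.1 < m ∧ e.2 < m) ∧ ∀ v w, v < m → w < m → adjB E' v w = adjB E v w := by
  refine ⟨((List.range m).product (List.range m)).filter fun e => adjB E e.1 e.2, ?_, ?_, ?_⟩
  · refine (List.length_filter_le _ _).trans ?_
    exact (List.length_product _ _).le.trans (by simp)
  · intro e he
    have := List.mem_product.1 (List.mem_filter.1 he).1
    simpa using this
  · intro v w hv hw
    have hsymm : adjB E w v = adjB E v w := by
      simp only [adjB, eq_comm (a := v), Bool.or_comm]
    rw [Bool.eq_iff_iff]
    constructor
    · intro h
      simp only [adjB, Bool.and_eq_true, List.any_eq_true, Bool.or_eq_true,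
        decide_eq_true_eq] at h
      obtain ⟨-, ⟨x, y⟩, he, ⟨rfl, rfl⟩ | ⟨rfl, rfl⟩⟩ := h
      · exact (List.mem_filter.1 he).2
      · rw [← hsymm]; exact (List.mem_filter.1 he).2
    · intro h
      have h0 := h
      simp only [adjB, Bool.and_eq_true] at h0
      simp only [adjB, Bool.and_eq_true, h0.1, List.any_eq_true, Bool.or_eq_true,
        decide_eq_true_eq, true_and]
      refine ⟨(v, w), List.mem_filter.2 ⟨?_, h⟩, Or.inl ⟨rfl, rfl⟩⟩
      exact List.mem_product.2 ⟨List.mem_range.2 hv, List.mem_range.2 hw⟩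

/-- Only the edge list has to be replaced. All other parts are already small: the table is spelled
out in the input, and the orderings are permutations of the goods. -/
theorem exists_small_cert : ∃ B : Polynomial ℕ, ∀ (q : Query) (c : Cert), check q c = true →
    ∃ c', check q c' = true ∧ esize c' ≤ B.eval (esize q) := by
  let X : Polynomial ℕ := Polynomial.X
  -- The five summands bound the goods, edges, table, ordering and split in terms of the input
  -- length; the final 4 accounts for the four pairings.
  refine ⟨(4 * X + 1) + (X * X * (8 * X + 4) + 1) + (X * (X * (8 * X + 4) + 2) + 1) +
    (X * (4 * X + 2) + 1) + (X * (X * (4 * X + 2) + 2) + 1) + 4, ?_⟩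
  rintro ⟨w, qs⟩ ⟨ms, E, rows, ord, P⟩ h
  obtain ⟨E', hE1, hE2, hE3⟩ := exists_edges E ms.length
  simp only [check, Bool.and_eq_true, decide_eq_true_eq] at h
  obtain ⟨h1, h2, h3, h4⟩ := h
  have hw := h2
  have hs := h3
  simp only [wfB, Bool.and_eq_true, List.all_eq_true, decide_eq_true_eq, permB_iff] at h2
  simp only [splitB, Bool.and_eq_true, List.all_eq_true, decide_eq_true_eq, permB_iff] at h3
  obtain ⟨-, -, h2a, h2b, h2c⟩ := h2
  obtain ⟨h3a, h3b, h3c⟩ := h3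
  have hord : ∀ x ∈ ord, x < ms.length := fun x hx => List.mem_range.1 (h2c.mem_iff.1 hx)
  have hP : ∀ l ∈ P, ∀ x ∈ l, x < ms.length := fun l hl x hx =>
    List.mem_range.1 (h3c.mem_iff.1 (List.mem_flatten.2 ⟨l, hl, hx⟩))
  refine ⟨(ms, E', rows, ord, P), ?_, ?_⟩
  · have e1 : encodeB ms E' rows = encodeB ms E rows := by
      rw [encodeB, encodeB]
      congr 3
      refine List.flatMap_congr fun v hv => List.flatMap_congr fun w hw => ?_
      rw [hE3 v w (List.mem_range.1 hv) (List.mem_range.1 hw)]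
    have e2 : wfB ms E' rows ord = true := by
      rwa [wfB, connB_congr hE3 ord hord]
    have e3 : splitB ms E' rows P = true := by
      simp only [splitB, Bool.and_eq_true, List.all_eq_true, decide_eq_true_eq, permB_iff]
      exact ⟨h3a, fun l hl => (connB_congr hE3 l (hP l hl)).trans (h3b l hl), h3c⟩
    simp only [check, Bool.and_eq_true, decide_eq_true_eq]
    exact ⟨h1.trans e1.symm, e2, e3, h4⟩
  · have hk : w.length ≤ esize (w, qs) := by
      have := length_le_esize w
      simp only [esize_pair]
      omega
    refine le_trans ?_ (eval_mono _ hk)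
    generalize hK : w.length = k
    rw [h1, encodeB] at hK
    simp only [List.length_append, List.length_map] at hK
    have hm : ms.length ≤ k := by omega
    have hn : rows.length ≤ k := by omega
    have hv : ∀ x < ms.length, esize x ≤ 4 * k + 1 := fun x hx => by
      have := esize_nat_le x
      have := size_le_self x
      omega
    have b1 : esize ms ≤ 4 * k + 1 := (esize_bits_le ms).trans (by omega)
    have b2 : esize E' ≤ k * k * (8 * k + 4) + 1 := by
      refine esize_list_le_of_length (hE1.trans (Nat.mul_le_mul hm hm)) fun e he => ?_
      have := hv _ (hE2 e he).1
      have := hv _ (hE2 e he).2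
      rw [esize_pair]
      omega
    have b3 : esize rows ≤ k * (k * (8 * k + 4) + 2) + 1 := by
      refine esize_list_le_of_length hn fun r hr => esize_list_le_of_length
        ((h2a r hr).1.trans_le hm) fun p hp => ?_
      have l1 := length_le_length_flatMap (f := fun r : List (ℕ × ℕ) => r.flatMap fun p =>
        encodeNat p.1 ++ encodeNat p.2) hr
      have l2 := length_le_length_flatMap (f := fun p : ℕ × ℕ =>
        encodeNat p.1 ++ encodeNat p.2) hp
      have l3 := size_le_length_encodeNat p.1
      have l4 := size_le_length_encodeNat p.2
      have l5 := esize_nat_le p.1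
      have l6 := esize_nat_le p.2
      rw [List.length_append] at l2
      rw [esize_pair]
      omega
    have b4 : esize ord ≤ k * (4 * k + 2) + 1 := by
      refine esize_list_le_of_length ?_ fun x hx => hv x (hord x hx)
      rw [h2c.length_eq, List.length_range]
      exact hm
    have b5 : esize P ≤ k * (k * (4 * k + 2) + 2) + 1 := by
      refine esize_list_le_of_length (h3a.trans_le hn) fun l hl =>
        esize_list_le_of_length ?_ fun x hx => hv x (hP l hl x hx)
      refine (List.sublist_flatten_of_mem hl).length_le.trans ?_
      rw [h3c.length_eq, List.length_range]
      exact hm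
    simp only [esize_pair, X, Polynomial.eval_add, Polynomial.eval_mul, Polynomial.eval_X,
      Polynomial.eval_ofNat, Polynomial.eval_one]
    omega

/-! ### The maximin share as a greatest number -/

namespace Instance
variable (I : Instance)

theorem scale_pos (i : Fin I.n) : 0 < I.scale i :=
  Finset.prod_pos fun v _ => Nat.cast_pos.2 (I.den_pos i v)

theorem utility_nonneg (i : Fin I.n) (v : Fin I.m) : 0 ≤ I.utility i v :=
  div_nonneg (Nat.cast_nonneg _) (Nat.cast_nonneg _)

theorem isGreatest_mms (i : Fin I.n) :
    IsGreatest (strongValues I.G (I.utility i) I.n) (mms I.G (I.utility i) I.n) :=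
  mms_isGreatest I.G I.connected _ (I.utility_nonneg i) I.n I.n_pos

/-- The maximum is attained, so an optimal split serves all smaller thresholds at once; this
monotonicity is what the search for digits uses. -/
theorem exists_strong_iff (i : Fin I.n) (x : ℝ) (hx : 0 ≤ x) :
    (∃ P : Fin I.n → Finset (Fin I.m), IsSplit I.G P ∧
      ∀ j, x ≤ I.scale i * value (I.utility i) (P j)) ↔
      x ≤ I.scale i * mms I.G (I.utility i) I.n := by
  have hs := I.scale_pos i
  constructor
  · rintro ⟨P, hP, h⟩
    rw [mul_comm, ← div_le_iff₀ hs]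
    refine (I.isGreatest_mms i).2 ⟨div_nonneg hx hs.le, P, hP, fun j => ?_⟩
    rw [div_le_iff₀ hs, mul_comm]
    exact h j
  · intro h
    obtain ⟨-, P, hP, hq⟩ := (I.isGreatest_mms i).1
    exact ⟨P, hP, fun j => h.trans (mul_le_mul_of_nonneg_left (hq j) hs.le)⟩

theorem exists_nat_scale_mul (i : Fin I.n) (S : Finset (Fin I.m)) :
    ∃ k : ℕ, (k : ℝ) = I.scale i * value (I.utility i) S := by
  refine ⟨scaledB (S.toList.map Fin.val) (rowAt I.table i), ?_⟩
  rw [scaledB_rowAt]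
  congr 2
  ext v
  rw [mem_nodes, List.mem_map_of_injective Fin.val_injective, Finset.mem_toList]

/-- In an optimal split the scaled values of the parts are integers, so they reach even the ceiling
of the scaled maximin share. By maximality the ceiling does not exceed that share, which is
therefore an integer. -/
theorem scale_mul_mms_le_floor (i : Fin I.n) :
    I.scale i * mms I.G (I.utility i) I.n ≤ ⌊I.scale i * mms I.G (I.utility i) I.n⌋₊ := by
  have hs := I.scale_pos i
  obtain ⟨h0, P, hP, hq⟩ := (I.isGreatest_mms i).1
  have hc : (⌈I.scale i * mms I.G (I.utility i) I.n⌉₊ : ℝ) ≤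
      I.scale i * mms I.G (I.utility i) I.n := by
    rw [← I.exists_strong_iff i _ (Nat.cast_nonneg _)]
    refine ⟨P, hP, fun j => ?_⟩
    obtain ⟨k, hk⟩ := I.exists_nat_scale_mul i (P j)
    rw [← hk, Nat.cast_le, Nat.ceil_le, hk]
    exact mul_le_mul_of_nonneg_left (hq j) hs.le
  exact (Nat.le_ceil _).trans (Nat.cast_le.2 (Nat.le_floor hc))

theorem floor_le_iff (i : Fin I.n) (S : Finset (Fin I.m)) :
    (⌊I.scale i * mms I.G (I.utility i) I.n⌋₊ : ℝ) ≤ I.scale i * value (I.utility i) S ↔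
      mms I.G (I.utility i) I.n ≤ value (I.utility i) S := by
  have hs := I.scale_pos i
  obtain ⟨h0, -⟩ := (I.isGreatest_mms i).1
  refine Iff.trans ?_ (mul_le_mul_iff_right₀ hs)
  exact ⟨(I.scale_mul_mms_le_floor i).trans, (Nat.floor_le (mul_nonneg hs.le h0)).trans⟩

theorem n_le_length_encode : I.n ≤ I.encode.length := by
  simp only [encode, encodeUnary, List.length_append, List.length_replicate]
  omega

theorem one_add_sum_le_prod {ι : Type} (s : Finset ι) (x : ι → ℝ) (hx : ∀ i, 0 ≤ x i) :
    1 + ∑ i ∈ s, x i ≤ ∏ i ∈ s, (1 + x i) := by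
  classical
  induction s using Finset.induction_on with
  | empty => simp
  | insert a s ha ih =>
    rw [Finset.sum_insert ha, Finset.prod_insert ha]
    have h1 : 0 ≤ ∑ i ∈ s, x i := Finset.sum_nonneg fun i _ => hx i
    nlinarith [hx a, mul_le_mul_of_nonneg_left ih (hx a), mul_nonneg (hx a) h1]

/-- With D the product of the denominators, D (1 + Σ u(v)) ≤ ∏ den(v) (1 + u(v)) = ∏ (den(v) +
num(v)), and each factor is at most 2 to the length of the code of its fraction. The summand 1 makes
the final inequality strict, as D > 0. -/
theorem scale_mul_lt (i : Fin I.n) (S : Finset (Fin I.m)) :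
    I.scale i * value (I.utility i) S < 2 ^ I.encode.length := by
  let len : Fin I.m → ℕ := fun v => (encodeNat (I.num i v) ++ encodeNat (I.den i v)).length
  have hlen : ∑ v, len v ≤ I.encode.length := by
    have h1 := length_le_length_flatMap (f := fun i => (List.finRange I.m).flatMap fun v =>
      encodeNat (I.num i v) ++ encodeNat (I.den i v)) (List.mem_finRange i)
    have h2 : ((List.finRange I.m).flatMap fun v =>
        encodeNat (I.num i v) ++ encodeNat (I.den i v)).length = ∑ v, len v := by
      rw [List.length_flatMap, Fin.sum_univ_def]
    rw [← h2]
    refine h1.trans ?_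
    simp only [encode, List.length_append]
    omega
  have hv : value (I.utility i) S ≤ ∑ v, I.utility i v :=
    Finset.sum_le_sum_of_subset_of_nonneg (Finset.subset_univ _) fun v _ _ => I.utility_nonneg i v
  have h1 := one_add_sum_le_prod Finset.univ (I.utility i) (I.utility_nonneg i)
  have h2 : I.scale i * ∏ v, (1 + I.utility i v) ≤ ∏ v, (2 : ℝ) ^ len v := by
    rw [scale, ← Finset.prod_mul_distrib]
    refine Finset.prod_le_prod (fun v _ => mul_nonneg (Nat.cast_nonneg _)
      (by have := I.utility_nonneg i v; linarith)) fun v _ => ?_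
    have hd : (I.den i v : ℝ) ≠ 0 := by exact_mod_cast (I.den_pos i v).ne'
    have : (I.den i v : ℝ) * (1 + I.utility i v) = ((I.den i v + I.num i v : ℕ) : ℝ) := by
      rw [utility]
      push_cast
      field_simp
    rw [this]
    -- The sum is less than (num + 1)(den + 1), and each of these factors is at most 2 to the length
    -- of its code.
    have : I.den i v + I.num i v ≤ 2 ^ len v := by
      have e1 : ∀ k : ℕ, k < 2 ^ (encodeNat k).length := fun k =>
        (Nat.lt_size_self k).trans_le
          (Nat.pow_le_pow_right (by norm_num) (size_le_length_encodeNat k))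
      have e2 := e1 (I.num i v)
      have e3 := e1 (I.den i v)
      simp only [len, List.length_append, pow_add]
      nlinarith [Nat.mul_le_mul (Nat.succ_le_of_lt e2) (Nat.succ_le_of_lt e3), I.den_pos i v]
    exact_mod_cast this
  have h3 : ∏ v, (2 : ℝ) ^ len v ≤ 2 ^ I.encode.length := by
    rw [Finset.prod_pow_eq_pow_sum]
    exact pow_le_pow_right₀ (by norm_num) hlen
  have hs := I.scale_pos i
  nlinarith [mul_le_mul_of_nonneg_left hv hs.le, mul_le_mul_of_nonneg_left h1 hs.le]

theorem floor_lt (i : Fin I.n) :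
    ⌊I.scale i * mms I.G (I.utility i) I.n⌋₊ < 2 ^ I.encode.length := by
  obtain ⟨h0, P, hP, hq⟩ := (I.isGreatest_mms i).1
  have hs := I.scale_pos i
  rw [Nat.floor_lt (mul_nonneg hs.le h0)]
  push_cast
  exact (mul_le_mul_of_nonneg_left (hq i) hs.le).trans_lt (I.scale_mul_lt i (P i))

end Instance

/-! ### The oracle algorithm -/

/-- One step of the search for the binary digits of a number, by comparisons. -/
def greedyStep (ask : ℕ → Bool) (s : List Bool × List Bool) : List Bool × List Bool :=
  (s.1.tail, ask (natOfBits (s.1.tail ++ true :: s.2)) :: s.2)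

/-- The binary digits, as many as `w` has, of the greatest number with a positive answer. -/
def greedy (ask : ℕ → Bool) (w : List Bool) : List Bool :=
  (w.foldl (fun s _ => greedyStep ask s) (w.map fun _ => false, [])).2

/-- The invariant is p · 2^k ≤ M < (p + 1) · 2^k, where p is given by the leading digits found and k
digits remain. The next digit is 1 exactly if (2p + 1) · 2^(k-1) ≤ M, and that is what is asked; the
zeros in the state supply the factor 2^(k-1). -/
theorem natOfBits_greedy {ask : ℕ → Bool} {M : ℕ} (h : ∀ T, ask T = true ↔ T ≤ M) (w : List Bool)
    (hM : M < 2 ^ w.length) : natOfBits (greedy ask w) = M := by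
  have hz : ∀ k, natOfBits (List.replicate k false) = 0 := by
    intro k
    induction k with
    | zero => rfl
    | succ k ih => rw [List.replicate_succ, natOfBits_cons, ih]; rfl
  have key : ∀ (l p : List Bool), natOfBits p * 2 ^ l.length ≤ M →
      M < (natOfBits p + 1) * 2 ^ l.length →
      natOfBits (l.foldl (fun s _ => greedyStep ask s) (List.replicate l.length false, p)).2 =
        M := by
    intro l
    induction l with
    | nil => intro p h1 h2; simp at h1 h2 ⊢; omega
    | cons b l ih =>
      intro p h1 h2
      rw [List.length_cons, pow_succ'] at h1 h2
      have e : natOfBits (List.replicate l.length false ++ true :: p) =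
          (2 * natOfBits p + 1) * 2 ^ l.length := by
        rw [natOfBits_append, hz, natOfBits_cons, List.length_replicate]
        simp
        ring
      rw [List.length_cons, List.foldl_cons, greedyStep, List.replicate_succ]
      simp only [List.tail_cons, e]
      apply ih
      · rw [natOfBits_cons]
        cases ha : ask ((2 * natOfBits p + 1) * 2 ^ l.length)
        · simp only [Bool.toNat_false]
          linarith
        · simpa using (h _).1 ha
      · rw [natOfBits_cons]
        cases ha : ask ((2 * natOfBits p + 1) * 2 ^ l.length)
        · have : ¬(2 * natOfBits p + 1) * 2 ^ l.length ≤ M := fun e => by simp [(h _).2 e] at ha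
          simpa using this
        · simp only [Bool.toNat_true]
          linarith
  have := key w [] (by simp) (by simpa using hM)
  rwa [greedy, List.map_const']

/-- The query whether there is an allocation for the thresholds found by `greedy`. -/
def finalQuery (ask : Query → Bool) (w : List Bool) : Query :=
  (w, (List.range w.length).map fun i =>
    (i, natOfBits (greedy (fun T => ask (w, w.map fun _ => (i, T))) w)))

end FairDivision

namespace Complexity.PolyTime

open FairDivision

variable {A : Language Bool}

/-- Each of the `|w|` possible agents costs `|w|` oracle calls. In every round the state gains one
digit, of size at most 3, and its list cell, whence the bound 4. -/
theorem finalQuery {ask : Query → Bool} (ha : PolyTime A ask) : PolyTime A (finalQuery ask) := by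
  have h1 : PolyTime A fun p : ((List Bool × ℕ) × (List Bool × List Bool) × Bool) =>
      greedyStep (fun T => ask (p.1.1, p.1.1.map fun _ => (p.1.2, T))) p.2.1 := by
    have hw : PolyTime A fun p : ((List Bool × ℕ) × (List Bool × List Bool) × Bool) => p.1.1 :=
      id.fst.fst
    have hT : PolyTime A fun p : ((List Bool × ℕ) × (List Bool × List Bool) × Bool) =>
        Complexity.natOfBits (p.2.1.1.tail ++ true :: p.2.1.2) :=
      natOfBits (id.snd.fst.fst.tail.append ((const true).cons id.snd.fst.snd))
    have hq : PolyTime A fun p : (((List Bool × ℕ) × (List Bool × List Bool) × Bool) × Bool) =>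
        (p.1.1.2, Complexity.natOfBits (p.1.2.1.1.tail ++ true :: p.1.2.1.2)) :=
      pair id.fst.fst.snd (hT.comp id.fst)
    exact pair id.snd.fst.fst.tail ((ha.comp (pair hw (map hw hq))).cons id.snd.fst.snd)
  have h2 : PolyTime A fun p : List Bool × ℕ =>
      p.1.foldl (fun s _ => greedyStep (fun T => ask (p.1, p.1.map fun _ => (p.2, T))) s)
        (p.1.map fun _ => false, []) := by
    refine foldl_of_add (F := fun (p : List Bool × ℕ) s (_ : Bool) =>
      greedyStep (fun T => ask (p.1, p.1.map fun _ => (p.2, T))) s)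
      (i := fun p => (p.1.map fun _ => false, [])) h1 id.fst
      (pair (map (f := fun _ _ => false) id.fst (const false)) (const [])) (PolyBound.const 4) ?_
    rintro p ⟨x, y⟩ b -
    have e1 := esize_drop_le x 1
    rw [List.drop_one] at e1
    have e2 := esize_bool (ask (p.1, p.1.map fun _ => (p.2,
      Complexity.natOfBits (x.tail ++ true :: y))))
    simp only [greedyStep, esize_pair, esize_cons]
    omega
  have h3 : PolyTime A fun p : List Bool × ℕ => (p.2, Complexity.natOfBits
      (greedy (fun T => ask (p.1, p.1.map fun _ => (p.2, T))) p.1)) :=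
    pair id.snd (natOfBits h2.snd)
  exact pair id (map (range id) h3)

end Complexity.PolyTime

namespace FairDivision

open Complexity

/-- Deciding whether an mms-allocation exists is in `Δ₂ᵖ`. -/
theorem mmsAllocG_mem_DeltaTwoP : MmsAllocG ∈ DeltaTwoP := by
  classical
  obtain ⟨B, hB⟩ := exists_small_cert
  obtain ⟨A, hA, hq⟩ := exists_mem_NP (fun A => PolyTime.check (A := A)) B hB
  let ask : Query → Bool := fun q => decide ((HasRep.rep q).enc ∈ A)
  have hask : ∀ q, ask q = true ↔ ∃ c, check q c = true := fun q => by
    rw [← hq q, decide_eq_true_eq]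
  have ha : PolyTime A ask := PolyTime.oracle PolyTime.id
  refine ⟨A, hA, (ha.comp (PolyTime.finalQuery ha)).mem_PWith fun w => ?_⟩
  by_cases hw : ∃ I : Instance, I.encode = w
  · obtain ⟨I, rfl⟩ := hw
    have hn := I.n_le_length_encode
    -- A query with the same pair (i, T) in every place asks for a split all of whose parts are
    -- worth at least T to agent i, so the search finds the scaled maximin share of i.
    have hgreedy : ∀ i : Fin I.n, natOfBits (greedy (fun T => ask (I.encode,
        I.encode.map fun _ => ((i : ℕ), T))) I.encode) =
        ⌊I.scale i * mms I.G (I.utility i) I.n⌋₊ := by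
      intro i
      refine natOfBits_greedy (fun T => ?_) _ (I.floor_lt i)
      have h0 := mul_nonneg (I.scale_pos i).le (I.isGreatest_mms i).1.1
      rw [hask, exists_check_iff I _ (fun _ => i) (fun _ => T), Nat.le_floor_iff h0]
      · exact I.exists_strong_iff i T (Nat.cast_nonneg T)
      · intro j
        have hj : (j : ℕ) < I.encode.length := j.2.trans_le hn
        rw [List.getElem?_map, List.getElem?_eq_getElem hj]
        rfl
    -- In the final query place j belongs to agent j. The thresholds for indices from `I.n` on are
    -- meaningless, but they are never consulted.
    rw [hask, finalQuery, exists_check_iff I _ (fun j => j)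
      (fun j => ⌊I.scale j * mms I.G (I.utility j) I.n⌋₊)]
    · simp only [I.floor_le_iff]
      constructor
      · rintro ⟨J, hJ, P, hP⟩
        obtain rfl := Instance.encode_injective hJ
        exact ⟨P, hP⟩
      · rintro ⟨P, hP⟩
        exact ⟨I, rfl, P, hP⟩
    · intro j
      have hj : (j : ℕ) < I.encode.length := j.2.trans_le hn
      rw [List.getElem?_map, List.getElem?_range hj, Option.map_some, hgreedy]
  -- If the input encodes no instance, the answer is negative whatever the thresholds are, since an
  -- accepted certificate would describe an instance with that encoding.
  · refine iff_of_false (fun ⟨I, hI, _⟩ => hw ⟨I, hI⟩) fun h => ?_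
    obtain ⟨⟨ms, E, rows, ord, P⟩, hc⟩ := (hask _).1 h
    simp only [check, Bool.and_eq_true, decide_eq_true_eq] at hc
    obtain ⟨I, hI⟩ := Instance.exists_matches hc.2.1
    exact hw ⟨I, (hc.1.trans hI.encodeB_eq).symm⟩

end FairDivision

theorem mainTheorem10 : FairDivision.MmsAllocG ∈ Complexity.DeltaTwoP :=
  FairDivision.mmsAllocG_mem_DeltaTwoP
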